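/- Write $i'=8-i$ and regard $\mathfrak g=\mathfrak{so}_7(\mathbb C)$ (type $B_3$) as the Lie algebra of complex $7\times 7$ matrices $A=(a_{ij})$ with $a_{ij}=-a_{j'i'}$, with Cartan subalgebra $\mathfrak h$ of diagonal matrices $\mathrm{diag}(a_1,a_2,a_3,0,-a_3,-a_2,-a_1)$, root system $\Delta$, and simple roots $\alpha_1=\varepsilon_1-\varepsilon_2$, $\alpha_2=\varepsilon_2-\varepsilon_3$, $\alpha_3=\varepsilon_3$, where $\varepsilon_i$ takes such a matrix to $a_i$. Let $\Delta_2^+(k)$ be the set of positive roots in which $\alpha_2$ has coefficient $k$, and put $\mathfrak m^+_k=\bigoplus_{\alpha\in\Delta_2^+(k)}\mathfrak g_\alpha$ and $\mathfrak p=\mathfrak h\oplus\bigoplus_{\alpha\in\Delta\setminus\bigcup_{k>0}\Delta_2^+(k)}\mathfrak g_\alpha$, so that $\mathfrak g=\mathfrak p\oplus\mathfrak m^+_1\oplus\mathfrak m^+_2$. Let $G=SO_7(\mathbb C)$ be the corresponding matrix group and $P\subset G$ the parabolic subgroup with Lie algebra $\mathfrak p$. The $7$-dimensional Kähler C-space $(B_3,\alpha_2)$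 is the compact complex manifold $M=G/P$, whose holomorphic tangent space at the base point is $\mathfrak g/\mathfrak p\cong\mathfrak m^+_1\oplus\mathfrak m^+_2$. Its canonical metric $g_0$ is the Hermitian metric that is invariant under the compact real form $G\cap U(7)$ and is given at the base point by $g_0(X,\bar Y)=-k\,K(X,\bar Y)$ for $X,Y\in\mathfrak m^+_k$, with $\mathfrak m_1^+\perp\mathfrak m_2^+$; here $K(X,Y)=\tfrac12\mathrm{tr}(XY)$ is the Killing form up to a positive factor and $\bar Y=-Y^*$. This metric is Kähler–Einstein. **Theorem.** $M$ with the metric $g_0$, or any positive constant multiple of it, has nonnegative quadratic bisectional curvature: at every point of $M$, for every unitary frame $e_1,\dots,e_7$ of type $(1,0)$ tangent vectors and all real numbers $x_1,\dots,x_7$, $$\sum_{a,b=1}^7 R(e_a,\bar e_a,e_b,\bar e_b)\,(x_a-x_b)^2\ \ge\ 0,$$ where $R$ is the curvature tensor of the metric, in local holomorphic coordinates $$R_{i\bar jk\bar l}=-\frac{\partial^2 g_{i\bar j}}{\partial z_k\,\partial\bar z_l}+\sum_{p,q}g^{p\bar q}\,\frac{\partial g_{i\bar q}}{\partial z_k}\,\frac{\partial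 g_{p\bar j}}{\partial\bar z_l}.$$ -/

import Mathlib

open scoped Matrix Topology

noncomputable section

namespace KahlerCSpace

/-! ### The Lie algebra `B₃ = 𝔰𝔬₇(ℂ)`, its roots, and the grading given by the simple root `α₂` -/

/-- Complex `7 × 7` matrices. Indices run over `0, …, 6`, and `i.rev = 6 - i`. -/
abbrev Mat : Type := Matrix (Fin 7) (Fin 7) ℂ

/-- `𝔰𝔬₇(ℂ)`, as the matrices that are skew with respect to the anti-diagonal. -/
def so7 : Submodule ℂ Mat where
  carrier := {X | ∀ i j, X i j = -X j.rev i.rev}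
  add_mem' {X Y} hX hY i j := by
    rw [Matrix.add_apply, Matrix.add_apply, hX i j, hY i j]; ring
  zero_mem' i j := by simp
  smul_mem' c X hX i j := by
    rw [Matrix.smul_apply, Matrix.smul_apply, hX i j, smul_neg]

/-- The Cartan subalgebra `𝔥` of the diagonal matrices in `𝔰𝔬₇(ℂ)`. -/
def cartan : Submodule ℂ Mat where
  carrier := {X | X ∈ so7 ∧ ∀ i j, i ≠ j → X i j = 0}
  add_mem' {X Y} hX hY := ⟨so7.add_mem hX.1 hY.1, fun i j h => by
    rw [Matrix.add_apply, hX.2 i j h, hY.2 i j h, add_zero]⟩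
  zero_mem' := ⟨so7.zero_mem, fun i j _ => rfl⟩
  smul_mem' c X hX := ⟨so7.smul_mem c hX.1, fun i j h => by
    rw [Matrix.smul_apply, hX.2 i j h, smul_zero]⟩

/-- The simple roots `α₁ = ε₁ - ε₂`, `α₂ = ε₂ - ε₃`, `α₃ = ε₃`, evaluated at `H ∈ 𝔥`.
They are numbered `0, 1, 2` here. -/
def simpleRoot (H : Mat) : Fin 3 → ℂ := ![H 0 0 - H 1 1, H 1 1 - H 2 2, H 2 2]

/-- The space `𝔤_α` for `α = n₁ α₁ + n₂ α₂ + n₃ α₃`. -/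
def rootSpace (n : Fin 3 → ℤ) : Submodule ℂ Mat where
  carrier := {X | X ∈ so7 ∧ ∀ H ∈ cartan, H * X - X * H = (∑ i, (n i : ℂ) * simpleRoot H i) • X}
  add_mem' {X Y} hX hY := ⟨so7.add_mem hX.1 hY.1, fun H hH => by
    rw [smul_add, ← hX.2 H hH, ← hY.2 H hH, mul_add, add_mul]; abel⟩
  zero_mem' := ⟨so7.zero_mem, fun H _ => by simp⟩
  smul_mem' c X hX := ⟨so7.smul_mem c hX.1, fun H hH => by
    rw [smul_comm, ← hX.2 H hH, mul_smul_comm, smul_mul_assoc, smul_sub]⟩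

/-- The root system `Δ`, in coordinates with respect to the simple roots. -/
def roots : Set (Fin 3 → ℤ) := {n | n ≠ 0 ∧ rootSpace n ≠ ⊥}

/-- The positive roots `Δ⁺`. -/
def positiveRoots : Set (Fin 3 → ℤ) := {n | n ∈ roots ∧ ∀ i, 0 ≤ n i}

/-- `Δ₂⁺(k)`: the positive roots in which `α₂` has coefficient `k`. -/
def gradedRoots (k : ℕ) : Set (Fin 3 → ℤ) := {n | n ∈ positiveRoots ∧ n 1 = k}

/-- `𝔪⁺_k = ⨁_{α ∈ Δ₂⁺(k)} 𝔤_α`. -/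
def mPlus (k : ℕ) : Submodule ℂ Mat := ⨆ n ∈ gradedRoots k, rootSpace n

/-- The parabolic subalgebra `𝔭 = 𝔥 ⊕ ⨁_{α ∈ Δ ∖ Δ₂⁺} 𝔤_α`, where `Δ₂⁺ = ⋃_{k > 0} Δ₂⁺(k)`. -/
def parabolicAlgebra : Submodule ℂ Mat :=
  cartan ⊔ ⨆ n ∈ roots \ ⋃ k ∈ Set.Ioi (0 : ℕ), gradedRoots k, rootSpace n

/-- The Killing form of `𝔰𝔬₇(ℂ)`, rescaled to `K(F_{ij}, F_{kl}) = δ_{il}δ_{jk} - δ_{jl'}δ_{ik'}`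
for `F_{ij} = e_{ij} - e_{j'i'}`. -/
def killing (X Y : Mat) : ℂ := (X * Y).trace / 2

/-- The complex conjugation of `𝔰𝔬₇(ℂ)` that sends a Weyl basis vector `E_α` to `E_{-α}`;
it sends `F_{ij}` to `-F_{ji}`. -/
def conjugation (X : Mat) : Mat := -Xᴴ

/-! ### The complex Lie group and the homogeneous space `M = G/P` -/

/-- The matrix of the symmetric bilinear form that is preserved by `G`. -/
def formMatrix : Mat := Matrix.of fun i j => if j = i.rev then 1 else 0

/-- The complex Lie group `G = SO₇(ℂ)`, with Lie algebra `so7`. -/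
def SO7 : Subgroup (Matrix.SpecialLinearGroup (Fin 7) ℂ) where
  carrier := {g | (g : Mat)ᵀ * formMatrix * (g : Mat) = formMatrix}
  mul_mem' {g h} hg hh := by
    change (g : Mat)ᵀ * formMatrix * (g : Mat) = formMatrix at hg
    change (h : Mat)ᵀ * formMatrix * (h : Mat) = formMatrix at hh
    change ((g * h : Matrix.SpecialLinearGroup (Fin 7) ℂ) : Mat)ᵀ * formMatrix
      * ((g * h : Matrix.SpecialLinearGroup (Fin 7) ℂ) : Mat) = formMatrix
    calc _ = (h : Mat)ᵀ * ((g : Mat)ᵀ * formMatrix * (g : Mat)) * (h : Mat) := by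
          simp [Matrix.transpose_mul, Matrix.mul_assoc]
      _ = formMatrix := by rw [hg, hh]
  one_mem' := by simp
  inv_mem' {g} hg := by
    change (g : Mat)ᵀ * formMatrix * (g : Mat) = formMatrix at hg
    change ((g⁻¹ : Matrix.SpecialLinearGroup (Fin 7) ℂ) : Mat)ᵀ * formMatrix
      * ((g⁻¹ : Matrix.SpecialLinearGroup (Fin 7) ℂ) : Mat) = formMatrix
    have h1 : (g : Mat) * ((g⁻¹ : Matrix.SpecialLinearGroup (Fin 7) ℂ) : Mat) = 1 := by
      rw [← Matrix.SpecialLinearGroup.coe_mul, mul_inv_cancel, Matrix.SpecialLinearGroup.coe_one]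
    have h2 : ((g⁻¹ : Matrix.SpecialLinearGroup (Fin 7) ℂ) : Mat)ᵀ * (g : Mat)ᵀ = 1 := by
      rw [← Matrix.transpose_mul, h1, Matrix.transpose_one]
    calc _ = ((g⁻¹ : Matrix.SpecialLinearGroup (Fin 7) ℂ) : Mat)ᵀ
            * ((g : Mat)ᵀ * formMatrix * (g : Mat))
            * ((g⁻¹ : Matrix.SpecialLinearGroup (Fin 7) ℂ) : Mat) := by rw [hg]
      _ = (((g⁻¹ : Matrix.SpecialLinearGroup (Fin 7) ℂ) : Mat)ᵀ * (g : Mat)ᵀ) * formMatrix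
            * ((g : Mat) * ((g⁻¹ : Matrix.SpecialLinearGroup (Fin 7) ℂ) : Mat)) := by
          simp only [Matrix.mul_assoc]
      _ = formMatrix := by rw [h1, h2, one_mul, mul_one]

/-- The matrix of an element of `G`. -/
def toMat (g : SO7) : Mat := ((g : Matrix.SpecialLinearGroup (Fin 7) ℂ) : Mat)

/-- The adjoint action of `G` on matrices, `X ↦ g X g⁻¹`. -/
def adjointAction (g : SO7) (X : Mat) : Mat := toMat g * X * toMat g⁻¹

lemma adjointAction_mul (g h : SO7) (X : Mat) :
    adjointAction (g * h) X = adjointAction g (adjointAction h X) := by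
  simp only [adjointAction, toMat, mul_inv_rev, Subgroup.coe_mul,
    Matrix.SpecialLinearGroup.coe_mul, Matrix.mul_assoc]

lemma adjointAction_one (X : Mat) : adjointAction 1 X = X := by
  simp [adjointAction, toMat]

/-- The parabolic subgroup `P ⊆ G` with Lie algebra `𝔭`. A parabolic subgroup is the normalizer
of its Lie algebra. -/
def parabolic : Subgroup SO7 where
  carrier := {g | ∀ X, adjointAction g X ∈ parabolicAlgebra ↔ X ∈ parabolicAlgebra}
  mul_mem' {g h} hg hh X := by rw [adjointAction_mul, hg, hh]
  one_mem' X := by rw [adjointAction_one]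
  inv_mem' {g} hg X := by
    rw [← hg, ← adjointAction_mul, mul_inv_cancel, adjointAction_one]

/-- The Kähler C-space `(B₃, α₂) = G/P`. -/
abbrev Space : Type := SO7 ⧸ parabolic

/-- The compact real form `SO₇(ℂ) ∩ U(7)` of `G`; its Lie algebra is the set of fixed points of
`conjugation`. It acts transitively on `G/P`. -/
def compactForm : Set SO7 := {u | (toMat u)ᴴ * toMat u = 1}

/-! ### The canonical metric

The tangent space of `M = G/P` at `x = gP` is `𝔤 / Ad(g)𝔭`: the class of `A ∈ 𝔤` is the velocity
at `t = 0` of `exp(tA) x`. So Hermitian forms on this tangent space are written as forms on `𝔤`.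
At the base point it is `𝔤/𝔭 = 𝔪⁺ = 𝔪⁺₁ ⊕ 𝔪⁺₂`. -/

/-- The components in `𝔪⁺₁` and `𝔪⁺₂` of `A ∈ 𝔤 = 𝔭 ⊕ 𝔪⁺₁ ⊕ 𝔪⁺₂`. -/
def components (A : Mat) : Mat × Mat :=
  Classical.epsilon fun X : Mat × Mat =>
    X.1 ∈ mPlus 1 ∧ X.2 ∈ mPlus 2 ∧ A - X.1 - X.2 ∈ parabolicAlgebra

/-- The canonical metric at the base point: `g₀(X, Ȳ) = -k K(X, Ȳ)` on `𝔪⁺_k`,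
with `𝔪⁺₁` and `𝔪⁺₂` orthogonal. -/
def baseMetric (A B : Mat) : ℂ :=
  -killing (components A).1 (conjugation (components B).1)
    - 2 * killing (components A).2 (conjugation (components B).2)

/-- An element of the compact real form that takes the base point to `x`. -/
def transporter (x : Space) : SO7 :=
  Classical.epsilon fun u : SO7 => u ∈ compactForm ∧ (QuotientGroup.mk u : Space) = x

/-- The canonical metric `g₀` of `M`: the metric that is invariant under the compact real form and
is `baseMetric` at the base point. -/
def canonicalMetric (x : Space) (A B : Mat) : ℂ :=
  baseMetric (adjointAction (transporter x)⁻¹ A) (adjointAction (transporter x)⁻¹ B)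

/-! ### Holomorphic coordinates and curvature -/

/-- The partial derivative of a matrix-valued holomorphic function of seven variables. -/
def partialDeriv (f : (Fin 7 → ℂ) → Mat) (i : Fin 7) (z : Fin 7 → ℂ) : Mat :=
  Matrix.of fun a b => fderiv ℂ (fun w => f w a b) z (Pi.single i 1)

/-- Local holomorphic coordinates on `M = G/P`: an open set of `ℂ⁷` and an injective map
`z ↦ lift z • P` on it, given by a holomorphic map `lift` into `G`, whose differential into the
tangent space `𝔤 / Ad(lift z)𝔭` is injective (so bijective) at every point. Every holomorphic chart
of `G/P` is locally of this form because `G → G/P` has local holomorphic sections. -/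
structure Coordinates where
  domain : Set (Fin 7 → ℂ)
  isOpen_domain : IsOpen domain
  lift : (Fin 7 → ℂ) → SO7
  holomorphic : ∀ a b, DifferentiableOn ℂ (fun z => toMat (lift z) a b) domain
  injOn : Set.InjOn (fun z => (QuotientGroup.mk (lift z) : Space)) domain
  immersive : ∀ z ∈ domain, ∀ v : Fin 7 → ℂ,
    adjointAction (lift z)⁻¹
      (∑ i, v i • (partialDeriv (fun w => toMat (lift w)) i z * toMat (lift z)⁻¹))
        ∈ parabolicAlgebra → v = 0

/-- The point of `M` with coordinates `z`. -/
def Coordinates.point (φ : Coordinates) (z : Fin 7 → ℂ) : Space := QuotientGroup.mk (φ.lift z)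

/-- A representative in `𝔤` of the coordinate vector `∂/∂z_i` at the point with coordinates `z`. -/
def Coordinates.vector (φ : Coordinates) (z : Fin 7 → ℂ) (i : Fin 7) : Mat :=
  partialDeriv (fun w => toMat (φ.lift w)) i z * toMat (φ.lift z)⁻¹

/-- The coefficients `g_{i j̄}` of the canonical metric in the coordinates `φ`. -/
def Coordinates.metric (φ : Coordinates) (z : Fin 7 → ℂ) : Mat :=
  Matrix.of fun i j => canonicalMetric (φ.point z) (φ.vector z i) (φ.vector z j)

/-- The Wirtinger derivative `∂f/∂z_k`. -/
def dz (k : Fin 7) (f : (Fin 7 → ℂ) → ℂ) (z : Fin 7 → ℂ) : ℂ :=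
  (fderiv ℝ f z (Pi.single k 1) - Complex.I * fderiv ℝ f z (Pi.single k Complex.I)) / 2

/-- The Wirtinger derivative `∂f/∂z̄_k`. -/
def dzbar (k : Fin 7) (f : (Fin 7 → ℂ) → ℂ) (z : Fin 7 → ℂ) : ℂ :=
  (fderiv ℝ f z (Pi.single k 1) + Complex.I * fderiv ℝ f z (Pi.single k Complex.I)) / 2

/-- The curvature of a Kähler metric with coefficients `h z i j = g_{i j̄}(z)`:
`R_{i j̄ k l̄} = -∂²g_{i j̄}/∂z_k∂z̄_l + ∑_{p,q} g^{p q̄} (∂g_{i q̄}/∂z_k) (∂g_{p j̄}/∂z̄_l)`. -/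
def curvature (h : (Fin 7 → ℂ) → Mat) (z : Fin 7 → ℂ) (i j k l : Fin 7) : ℂ :=
  -dz k (dzbar l fun w => h w i j) z
    + ∑ p, ∑ q, (h z)⁻¹ q p * dz k (fun w => h w i q) z * dzbar l (fun w => h w p j) z

/-- `R(X, Ȳ, Z, W̄)` for type `(1,0)` vectors with components `X i`, `Y i`, `Z i`, `W i`. -/
def curvatureTensor (h : (Fin 7 → ℂ) → Mat) (z : Fin 7 → ℂ) (X Y Z W : Fin 7 → ℂ) : ℂ :=
  ∑ i, ∑ j, ∑ k, ∑ l,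
    curvature h z i j k l * X i * (starRingEnd ℂ) (Y j) * Z k * (starRingEnd ℂ) (W l)

/-- The vectors `e 0, …, e 6` of type `(1,0)`, with components `e a i`, form a unitary frame for the
Hermitian matrix `h`. -/
def IsUnitaryFrame (h : Mat) (e : Fin 7 → Fin 7 → ℂ) : Prop :=
  ∀ a b, ∑ i, ∑ j, h i j * e a i * (starRingEnd ℂ) (e b j) = if a = b then 1 else 0

/-- Nonnegative quadratic bisectional curvature at the point with coordinates `z`. -/
def NonnegQuadraticBisectional (h : (Fin 7 → ℂ) → Mat) (z : Fin 7 → ℂ) : Prop :=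
  ∀ e : Fin 7 → Fin 7 → ℂ, IsUnitaryFrame (h z) e → ∀ x : Fin 7 → ℝ,
    0 ≤ ∑ a, ∑ b, (curvatureTensor h z (e a) (e a) (e b) (e b)).re * (x a - x b) ^ 2

end KahlerCSpace

end

/-! ### Holomorphic functions of several variables -/

section Holomorphic

variable {E : Type*} [NormedAddCommGroup E] [NormedSpace ℂ E]

/-! The space `M` is the variety of isotropic planes in `ℂ⁷`: the group `parabolic` fixes the plane
spanned by the last two basis vectors. The factor `k` in `g₀` is exactly what makes `g₀` the metric
induced from the Grassmannian of planes. An element of `𝔪⁺₁` has half of its entries in the last two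
columns and their mirror images in the first two rows, while an element of `𝔪⁺₂` lies entirely in
the last two columns; with weights 1 and 2 both norms become the Hilbert–Schmidt norm of the upper
`5 × 2` block (`baseMetric_eq`). The compact form is transitive (`exists_compactForm`), so after a
unitary change of basis the planes near any point are graphs of a holomorphic `Y` that vanishes at
that point, with the usual Grassmannian formula for the metric (`Coordinates.exists_affine`).

Since `Y = 0` at the point, the second-order jet of the metric is short (`hasJet_metric`), and the
curvature obeys a Gauss equation: it is the curvature of the Grassmannian minus the squared norm of
the normal part of the second derivative of `Y`. The tangential part is cancelled by the term with
the inverse metric (`curvatureTensor_frame`, `sum_trace_mul_trace`). Differentiating the isotropy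
equation twice expresses the normal part through the first derivatives
(`matDeriv_matDeriv_isotropic`). Hence `R(X, X̄, W, W̄) = Q(X ⊗ X̄, W ⊗ W̄)` for an explicit
bilinear form `Q`, called `curvForm` (`curvForm_rankOne`).

A unitary frame gives orthogonal projections `P_a` with sum 1. Put `A = ∑ x_a P_a`, so that `A² = ∑
x_a² P_a`. Expanding `(x_a - x_b)²` turns the sum in question into `Q(A², 1) + Q(1, A²) - 2 Q(A,
A)`, and the Einstein condition `Q(·, 1) = Q(1, ·) = 4 tr` makes this `8 tr A² - 2 Q(A, A)`. What
remains is that `Q(A, A) ≤ 4 tr A²` for Hermitian `A`, with equality at `A = 1`; `curvForm_self_le`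
proves it by an explicit sum of squares. -/

lemma hasDerivAt_comp_line {f : E → ℂ} {z : E} (hf : DifferentiableAt ℂ f z) (v : E) :
    HasDerivAt (fun ζ : ℂ => f (z + ζ • v)) (fderiv ℂ f z v) 0 := by
  have h1 : HasDerivAt (fun ζ : ℂ => z + ζ • v) v 0 := by
    simpa using ((hasDerivAt_id (0 : ℂ)).smul_const v).const_add z
  have h2 : HasFDerivAt f (fderiv ℂ f z) (z + (0 : ℂ) • v) := by simpa using hf.hasFDerivAt
  exact h2.comp_hasDerivAt (0 : ℂ) h1

lemma differentiableOn_comp_line {f : E → ℂ} {s : Set E} (hf : DifferentiableOn ℂ f s) (z v : E)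
    {r : ℝ} (hr : ∀ ζ : ℂ, ‖ζ‖ ≤ r → z + ζ • v ∈ s) :
    DifferentiableOn ℂ (fun ζ : ℂ => f (z + ζ • v)) (Metric.closedBall 0 r) := by
  refine hf.comp (by fun_prop) fun ζ hζ => hr ζ (by simpa using hζ)

/-- Cauchy's estimate for the differential. -/
lemma norm_fderiv_le_of_forall_ball {f : E → ℂ} {z : E} {r C : ℝ} (hr : 0 < r) (hC : 0 ≤ C)
    (hf : DifferentiableOn ℂ f (Metric.closedBall z r))
    (hb : ∀ w ∈ Metric.closedBall z r, ‖f w‖ ≤ C) : ‖fderiv ℂ f z‖ ≤ C / r := by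
  have hz : DifferentiableAt ℂ f z := hf.differentiableAt (Metric.closedBall_mem_nhds z hr)
  refine ContinuousLinearMap.opNorm_le_bound _ (by positivity) fun v => ?_
  rcases eq_or_ne v 0 with rfl | hv
  · simp
  have hv' : 0 < ‖v‖ := norm_pos_iff.2 hv
  have hin : ∀ ζ : ℂ, ‖ζ‖ ≤ r / ‖v‖ → z + ζ • v ∈ Metric.closedBall z r := fun ζ hζ => by
    rw [mem_closedBall_iff_norm, add_sub_cancel_left, norm_smul]
    calc ‖ζ‖ * ‖v‖ ≤ r / ‖v‖ * ‖v‖ := by gcongr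
      _ = r := by field_simp
  have h := Complex.norm_deriv_le_of_forall_mem_sphere_norm_le (c := 0) (C := C)
    (f := fun ζ : ℂ => f (z + ζ • v)) (div_pos hr hv')
    ((differentiableOn_comp_line hf z v hin).mono Metric.closure_ball_subset_closedBall).diffContOnCl
    (fun ζ hζ => hb _ (hin ζ (by simpa using (mem_sphere_zero_iff_norm.1 hζ).le)))
  rw [(hasDerivAt_comp_line hz v).deriv] at h
  calc _ ≤ C / (r / ‖v‖) := h
    _ = C / r * ‖v‖ := by field_simp

/-- The derivative in a fixed direction of a holomorphic function of several variables is
holomorphic. -/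
theorem differentiableOn_fderiv_apply [FiniteDimensional ℂ E] {f : E → ℂ} {s : Set E}
    (hf : DifferentiableOn ℂ f s)
    (hs : IsOpen s) (v : E) : DifferentiableOn ℂ (fun z => fderiv ℂ f z v) s := by
  intro z₀ hz₀
  apply DifferentiableAt.differentiableWithinAt
  borelize E
  have : ProperSpace E := FiniteDimensional.proper ℂ E
  have : SecondCountableTopology (E →L[ℂ] ℂ) := by
    have : FiniteDimensional ℂ (E →L[ℂ] ℂ) := inferInstance
    have : ProperSpace (E →L[ℂ] ℂ) := FiniteDimensional.proper ℂ _
    infer_instance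
  obtain ⟨ε, hε, hεs⟩ := Metric.isOpen_iff.1 hs z₀ hz₀
  -- The circles used below stay within distance `2R` of `z₀`, and Cauchy's estimate on balls of
  -- radius `R` around their points needs `3R`; with `4R = ε` the closed ball of radius `3R` still
  -- lies in `s`.
  set R := ε / 4 with hR
  have hRpos : 0 < R := by positivity
  have hbig : Metric.closedBall z₀ (3 * R) ⊆ s := fun w hw => hεs (by
    rw [Metric.mem_ball]; rw [Metric.mem_closedBall] at hw; linarith)
  obtain ⟨C, hC⟩ := (isCompact_closedBall z₀ (3 * R)).exists_bound_of_continuousOn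
    (hf.continuousOn.mono hbig)
  have hC0 : 0 ≤ C := (norm_nonneg _).trans (hC z₀ (Metric.mem_closedBall_self (by positivity)))
  obtain ⟨r, hr, hrv⟩ : ∃ r : ℝ, 0 < r ∧ r * ‖v‖ ≤ R :=
    ⟨R / (‖v‖ + 1), by positivity, by
      rw [div_mul_eq_mul_div, div_le_iff₀ (by positivity)]; nlinarith [norm_nonneg v]⟩
  have hnear : ∀ z ∈ Metric.ball z₀ R, ∀ ζ : ℂ, ‖ζ‖ ≤ r →
      z + ζ • v ∈ Metric.closedBall z₀ (2 * R) := fun z hz ζ hζ => by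
    rw [mem_closedBall_iff_norm]
    rw [mem_ball_iff_norm] at hz
    calc ‖z + ζ • v - z₀‖ = ‖(z - z₀) + ζ • v‖ := by congr 1; abel
      _ ≤ ‖z - z₀‖ + ‖ζ‖ * ‖v‖ := (norm_add_le _ _).trans_eq (by rw [norm_smul])
      _ ≤ R + r * ‖v‖ := by gcongr
      _ ≤ 2 * R := by linarith
  have h23 : Metric.closedBall z₀ (2 * R) ⊆ s :=
    (Metric.closedBall_subset_closedBall (by linarith)).trans hbig
  have hbound : ∀ w ∈ Metric.closedBall z₀ (2 * R), ‖fderiv ℂ f w‖ ≤ C / R := fun w hw => by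
    have hsub : Metric.closedBall w R ⊆ Metric.closedBall z₀ (3 * R) :=
      Metric.closedBall_subset_closedBall' (by rw [Metric.mem_closedBall] at hw; linarith)
    exact norm_fderiv_le_of_forall_ball hRpos hC0 (hf.mono (hsub.trans hbig))
      fun x hx => hC x (hsub hx)
  have hcm : ∀ θ, ‖circleMap 0 r θ‖ ≤ r := fun θ => by simp [abs_of_pos hr]
  -- The kernel of Cauchy's formula for the derivative at 0 of `ζ ↦ f (z + ζ • v)`. It writes the
  -- directional derivative as an integral of `f` itself, which can be differentiated in `z` under
  -- the integral sign.
  set k : ℝ → ℂ := fun θ => (2 * Real.pi * Complex.I : ℂ)⁻¹ *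
    (deriv (circleMap 0 r) θ * ((circleMap 0 r θ) ^ 2)⁻¹) with hk
  have hkc : Continuous k := by
    have h1 : ∀ θ, (circleMap 0 r θ) ^ 2 ≠ 0 := fun θ =>
      pow_ne_zero _ (circleMap_ne_center hr.ne')
    have h2 : Continuous fun θ => circleMap 0 r θ := continuous_circleMap 0 r
    simp only [hk, deriv_circleMap]
    exact continuous_const.mul ((h2.mul continuous_const).mul ((h2.pow 2).inv₀ h1))
  have hcauchy : ∀ z ∈ Metric.ball z₀ R,
      fderiv ℂ f z v = ∫ θ in (0 : ℝ)..2 * Real.pi, k θ * f (z + circleMap 0 r θ • v) := by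
    intro z hz
    have hzs : z ∈ s := h23 (by simpa using hnear z hz 0 (by simpa using hr.le))
    have hd := differentiableOn_comp_line hf z v (r := r) fun ζ hζ => h23 (hnear z hz ζ hζ)
    have h := hd.deriv_eq_smul_circleIntegral hr
    rw [(hasDerivAt_comp_line (hf.differentiableAt (hs.mem_nhds hzs)) v).deriv] at h
    have h2 : (2 * Real.pi * Complex.I : ℂ) ≠ 0 := by simp [Real.pi_ne_zero]
    rw [← inv_smul_smul₀ h2 (fderiv ℂ f z v), ← h, circleIntegral,
      ← intervalIntegral.integral_smul]
    refine intervalIntegral.integral_congr fun θ _ => ?_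
    simp only [hk, smul_eq_mul, sub_zero, one_div]
    ring
  have hint : HasFDerivAt
      (fun z => ∫ θ in (0 : ℝ)..2 * Real.pi, k θ * f (z + circleMap 0 r θ • v))
      (∫ θ in (0 : ℝ)..2 * Real.pi, k θ • fderiv ℂ f (z₀ + circleMap 0 r θ • v)) z₀ := by
    have hcont : ∀ z ∈ Metric.ball z₀ R, Continuous fun θ => k θ * f (z + circleMap 0 r θ • v) :=
      fun z hz => hkc.mul (hf.continuousOn.comp_continuous
        (continuous_const.add ((continuous_circleMap 0 r).smul continuous_const))
        fun θ => h23 (hnear z hz _ (hcm θ)))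
    refine intervalIntegral.hasFDerivAt_integral_of_dominated_of_fderiv_le
      (s := Metric.ball z₀ R) (bound := fun θ => ‖k θ‖ * (C / R))
      (F := fun z θ => k θ * f (z + circleMap 0 r θ • v))
      (F' := fun z θ => k θ • fderiv ℂ f (z + circleMap 0 r θ • v))
      (Metric.ball_mem_nhds z₀ hRpos) ?_ ?_ ?_ ?_ ?_ ?_
    · filter_upwards [Metric.ball_mem_nhds z₀ hRpos] with z hz
      exact (hcont z hz).aestronglyMeasurable
    · exact (hcont z₀ (Metric.mem_ball_self hRpos)).intervalIntegrable _ _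
    -- Continuity of the differential is not known at this stage; the general measurability of
    -- `fderiv` suffices.
    · apply Measurable.aestronglyMeasurable
      exact hkc.measurable.smul ((measurable_fderiv ℂ f).comp
        (continuous_const.add ((continuous_circleMap 0 r).smul continuous_const)).measurable)
    · refine Filter.Eventually.of_forall fun θ _ z hz => ?_
      rw [norm_smul]
      gcongr
      exact hbound _ (hnear z hz _ (hcm θ))
    · exact (hkc.norm.mul continuous_const).intervalIntegrable _ _
    · refine Filter.Eventually.of_forall fun θ _ z hz => ?_
      have hd : DifferentiableAt ℂ f (z + circleMap 0 r θ • v) :=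
        hf.differentiableAt (hs.mem_nhds (h23 (hnear z hz _ (hcm θ))))
      have h2 : HasFDerivAt (fun z => f (z + circleMap 0 r θ • v))
          (fderiv ℂ f (z + circleMap 0 r θ • v)) z :=
        (hasFDerivAt_comp_add_right _).2 hd.hasFDerivAt
      simpa using h2.const_mul (k θ)
  refine (hint.congr_of_eventuallyEq ?_).differentiableAt
  filter_upwards [Metric.ball_mem_nhds z₀ hRpos] with z hz using hcauchy z hz

/-- Induction on `n`, because every directional derivative is again holomorphic. The second-order
jets of the metric use `n = 2`. -/
theorem contDiffOn_of_differentiableOn_complex [FiniteDimensional ℂ E] {s : Set E}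
    (hs : IsOpen s) (n : ℕ) {f : E → ℂ} (hf : DifferentiableOn ℂ f s) : ContDiffOn ℂ n f s := by
  induction n generalizing f with
  | zero => exact contDiffOn_zero.2 hf.continuousOn
  | succ n ih =>
    push_cast
    refine (contDiffOn_succ_iff_fderiv_apply hs.uniqueDiffOn).2
      ⟨hf, by simp, fun v => ?_⟩
    exact (ih (differentiableOn_fderiv_apply hf hs v)).congr
      fun z hz => by rw [fderivWithin_of_isOpen hs hz]

end Holomorphic

noncomputable section

namespace KahlerCSpace

/-! ### Wirtinger calculus -/

section Wirtinger

variable {k l : Fin 7} {f g : (Fin 7 → ℂ) → ℂ} {z : Fin 7 → ℂ}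

lemma dz_congr (h : f =ᶠ[𝓝 z] g) : dz k f z = dz k g z := by
  simp only [dz, h.fderiv_eq]

lemma dzbar_congr (h : f =ᶠ[𝓝 z] g) : dzbar k f z = dzbar k g z := by
  simp only [dzbar, h.fderiv_eq]

lemma dzbar_eventuallyEq (h : f =ᶠ[𝓝 z] g) : dzbar k f =ᶠ[𝓝 z] dzbar k g := by
  filter_upwards [eventually_eventually_nhds.2 h] with w hw using dzbar_congr hw

lemma dz_const (c : ℂ) : dz k (fun _ => c) z = 0 := by simp [dz]

lemma dzbar_const (c : ℂ) : dzbar k (fun _ => c) z = 0 := by simp [dzbar]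

lemma dz_add (hf : DifferentiableAt ℝ f z) (hg : DifferentiableAt ℝ g z) :
    dz k (fun w => f w + g w) z = dz k f z + dz k g z := by
  simp only [dz, fderiv_fun_add hf hg, add_apply]; ring

lemma dzbar_add (hf : DifferentiableAt ℝ f z) (hg : DifferentiableAt ℝ g z) :
    dzbar k (fun w => f w + g w) z = dzbar k f z + dzbar k g z := by
  simp only [dzbar, fderiv_fun_add hf hg, add_apply]; ring

lemma dz_mul (hf : DifferentiableAt ℝ f z) (hg : DifferentiableAt ℝ g z) :
    dz k (fun w => f w * g w) z = dz k f z * g z + f z * dz k g z := by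
  simp only [dz, fderiv_fun_mul hf hg, add_apply,
    smul_apply, smul_eq_mul]; ring

lemma dzbar_mul (hf : DifferentiableAt ℝ f z) (hg : DifferentiableAt ℝ g z) :
    dzbar k (fun w => f w * g w) z = dzbar k f z * g z + f z * dzbar k g z := by
  simp only [dzbar, fderiv_fun_mul hf hg, add_apply,
    smul_apply, smul_eq_mul]; ring

lemma fderiv_conj (hf : DifferentiableAt ℝ f z) (v : Fin 7 → ℂ) :
    fderiv ℝ (fun w => (starRingEnd ℂ) (f w)) z v = (starRingEnd ℂ) (fderiv ℝ f z v) := by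
  have h := (Complex.conjCLE.toContinuousLinearMap.hasFDerivAt (x := f z)).comp z hf.hasFDerivAt
  have h2 : fderiv ℝ (fun w => (starRingEnd ℂ) (f w)) z = _ := h.fderiv
  rw [h2]; rfl

lemma dz_conj (hf : DifferentiableAt ℝ f z) :
    dz k (fun w => (starRingEnd ℂ) (f w)) z = (starRingEnd ℂ) (dzbar k f z) := by
  simp only [dz, dzbar, fderiv_conj hf, map_div₀, map_add, map_mul, Complex.conj_I,
    Complex.conj_ofNat]; ring

lemma dzbar_conj (hf : DifferentiableAt ℝ f z) :
    dzbar k (fun w => (starRingEnd ℂ) (f w)) z = (starRingEnd ℂ) (dz k f z) := by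
  simp only [dz, dzbar, fderiv_conj hf, map_div₀, map_sub, map_mul, Complex.conj_I,
    Complex.conj_ofNat]; ring

lemma fderiv_real_single_I (hf : DifferentiableAt ℂ f z) :
    fderiv ℝ f z (Pi.single k Complex.I) = Complex.I * fderiv ℂ f z (Pi.single k 1) := by
  have h : (Pi.single k Complex.I : Fin 7 → ℂ) = Complex.I • Pi.single k 1 := by
    rw [← Pi.single_smul, smul_eq_mul, mul_one]
  rw [hf.fderiv_restrictScalars ℝ, ContinuousLinearMap.coe_restrictScalars', h, map_smul,
    smul_eq_mul]

lemma dz_of_holomorphic (hf : DifferentiableAt ℂ f z) :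
    dz k f z = fderiv ℂ f z (Pi.single k 1) := by
  rw [dz, fderiv_real_single_I hf, hf.fderiv_restrictScalars ℝ,
    ContinuousLinearMap.coe_restrictScalars', ← mul_assoc, Complex.I_mul_I]; ring

lemma dzbar_of_holomorphic (hf : DifferentiableAt ℂ f z) : dzbar k f z = 0 := by
  rw [dzbar, fderiv_real_single_I hf, hf.fderiv_restrictScalars ℝ,
    ContinuousLinearMap.coe_restrictScalars', ← mul_assoc, Complex.I_mul_I]; ring

lemma ContDiffAt.eventually_differentiableAt (hf : ContDiffAt ℝ 2 f z) :
    ∀ᶠ w in 𝓝 z, DifferentiableAt ℝ f w := by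
  filter_upwards [hf.eventually (by simp)] with w hw using hw.differentiableAt (by simp)

lemma ContDiffAt.differentiableAt_dzbar (hf : ContDiffAt ℝ 2 f z) :
    DifferentiableAt ℝ (dzbar l f) z := by
  have h : DifferentiableAt ℝ (fderiv ℝ f) z :=
    (hf.fderiv_right (m := 1) (by norm_num)).differentiableAt (by simp)
  have h' : ∀ v, DifferentiableAt ℝ (fun w => fderiv ℝ f w v) z := fun v =>
    h.clm_apply (differentiableAt_const v)
  unfold dzbar
  exact (((h' _).add ((differentiableAt_const _).mul (h' _))).mul_const (2 : ℂ)⁻¹)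

end Wirtinger

/-- `f` is twice continuously differentiable at `z`, and its value and its derivatives `∂f/∂z_k`,
`∂f/∂z̄_l`, `∂²f/∂z_k∂z̄_l` there are `a`, `b`, `c`, `d`. -/
structure HasJet (k l : Fin 7) (z : Fin 7 → ℂ) (f : (Fin 7 → ℂ) → ℂ) (a b c d : ℂ) : Prop where
  smooth : ContDiffAt ℝ 2 f z
  value : f z = a
  dz_eq : dz k f z = b
  dzbar_eq : dzbar l f z = c
  mixed_eq : dz k (dzbar l f) z = d

/-! ### Second-order jets of sums, products, holomorphic and antiholomorphic functions -/

namespace HasJet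

variable {k l : Fin 7} {f g : (Fin 7 → ℂ) → ℂ} {z : Fin 7 → ℂ} {a b c d a' b' c' d' : ℂ}

lemma differentiableAt (hf : HasJet k l z f a b c d) : DifferentiableAt ℝ f z :=
  hf.smooth.differentiableAt (by simp)

lemma congr (hf : HasJet k l z f a b c d) (h : g =ᶠ[𝓝 z] f) : HasJet k l z g a b c d where
  smooth := hf.smooth.congr_of_eventuallyEq h
  value := h.eq_of_nhds.trans hf.value
  dz_eq := (dz_congr h).trans hf.dz_eq
  dzbar_eq := (dzbar_congr h).trans hf.dzbar_eq
  mixed_eq := (dz_congr (dzbar_eventuallyEq h)).trans hf.mixed_eq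

lemma const (x : ℂ) : HasJet k l z (fun _ => x) x 0 0 0 where
  smooth := contDiffAt_const
  value := rfl
  dz_eq := dz_const x
  dzbar_eq := dzbar_const x
  mixed_eq := by
    rw [show dzbar l (fun _ => x) = fun _ => 0 from funext fun w => dzbar_const x, dz_const]

lemma add (hf : HasJet k l z f a b c d) (hg : HasJet k l z g a' b' c' d') :
    HasJet k l z (fun w => f w + g w) (a + a') (b + b') (c + c') (d + d') where
  smooth := hf.smooth.add hg.smooth
  value := by rw [hf.value, hg.value]
  dz_eq := by rw [dz_add hf.differentiableAt hg.differentiableAt, hf.dz_eq, hg.dz_eq]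
  dzbar_eq := by rw [dzbar_add hf.differentiableAt hg.differentiableAt, hf.dzbar_eq, hg.dzbar_eq]
  mixed_eq := by
    have h : dzbar l (fun w => f w + g w) =ᶠ[𝓝 z] fun w => dzbar l f w + dzbar l g w := by
      filter_upwards [ContDiffAt.eventually_differentiableAt hf.smooth,
        ContDiffAt.eventually_differentiableAt hg.smooth] with w h1 h2 using dzbar_add h1 h2
    rw [dz_congr h, dz_add (ContDiffAt.differentiableAt_dzbar hf.smooth)
      (ContDiffAt.differentiableAt_dzbar hg.smooth), hf.mixed_eq, hg.mixed_eq]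

lemma mul (hf : HasJet k l z f a b c d) (hg : HasJet k l z g a' b' c' d') :
    HasJet k l z (fun w => f w * g w) (a * a') (b * a' + a * b') (c * a' + a * c')
      (d * a' + c * b' + b * c' + a * d') where
  smooth := hf.smooth.mul hg.smooth
  value := by rw [hf.value, hg.value]
  dz_eq := by
    rw [dz_mul hf.differentiableAt hg.differentiableAt, hf.dz_eq, hg.dz_eq, hf.value, hg.value]
  dzbar_eq := by
    rw [dzbar_mul hf.differentiableAt hg.differentiableAt, hf.dzbar_eq, hg.dzbar_eq, hf.value,
      hg.value]
  mixed_eq := by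
    have h : dzbar l (fun w => f w * g w) =ᶠ[𝓝 z]
        fun w => dzbar l f w * g w + f w * dzbar l g w := by
      filter_upwards [ContDiffAt.eventually_differentiableAt hf.smooth,
        ContDiffAt.eventually_differentiableAt hg.smooth] with w h1 h2 using dzbar_mul h1 h2
    have hf' := ContDiffAt.differentiableAt_dzbar (l := l) hf.smooth
    have hg' := ContDiffAt.differentiableAt_dzbar (l := l) hg.smooth
    rw [dz_congr h, dz_add (hf'.fun_mul hg.differentiableAt)
      (hf.differentiableAt.fun_mul hg'),
      dz_mul hf' hg.differentiableAt, dz_mul hf.differentiableAt hg', hf.mixed_eq, hg.mixed_eq,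
      hf.value, hg.value, hf.dz_eq, hg.dz_eq, hf.dzbar_eq, hg.dzbar_eq]
    ring

lemma sum {ι : Type*} (s : Finset ι) {f : ι → (Fin 7 → ℂ) → ℂ} {a b c d : ι → ℂ}
    (h : ∀ i, HasJet k l z (f i) (a i) (b i) (c i) (d i)) :
    HasJet k l z (fun w => ∑ i ∈ s, f i w) (∑ i ∈ s, a i) (∑ i ∈ s, b i) (∑ i ∈ s, c i)
      (∑ i ∈ s, d i) := by
  classical
  induction s using Finset.induction_on with
  | empty => simpa using const (k := k) (l := l) (z := z) 0
  | insert i s hi ih => simpa only [Finset.sum_insert hi] using (h i).add ih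

lemma of_holomorphic (hf : ∀ᶠ w in 𝓝 z, DifferentiableAt ℂ f w) :
    HasJet k l z f (f z) (fderiv ℂ f z (Pi.single k 1)) 0 0 := by
  obtain ⟨s, hs, hso, hzs⟩ := eventually_nhds_iff.1 hf
  have hd : DifferentiableOn ℂ f s := fun w hw => (hs w hw).differentiableWithinAt
  have h0 : dzbar l f =ᶠ[𝓝 z] fun _ => 0 := by
    filter_upwards [hf] with w hw using dzbar_of_holomorphic hw
  exact ⟨((contDiffOn_of_differentiableOn_complex hso 2 hd).contDiffAt
    (hso.mem_nhds hzs)).restrict_scalars ℝ, rfl, dz_of_holomorphic hf.self_of_nhds,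
    dzbar_of_holomorphic hf.self_of_nhds, by rw [dz_congr h0, dz_const]⟩

/-- The derivative in `z̄_l` is the conjugate of a holomorphic function, so `∂/∂z_k` kills it and
the mixed entry is zero. -/
lemma conj_of_holomorphic (hf : ∀ᶠ w in 𝓝 z, DifferentiableAt ℂ f w) :
    HasJet k l z (fun w => (starRingEnd ℂ) (f w)) ((starRingEnd ℂ) (f z)) 0
      ((starRingEnd ℂ) (fderiv ℂ f z (Pi.single l 1))) 0 := by
  obtain ⟨s, hs, hso, hzs⟩ := eventually_nhds_iff.1 hf
  have hd : DifferentiableOn ℂ f s := fun w hw => (hs w hw).differentiableWithinAt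
  have hR : ∀ {f : (Fin 7 → ℂ) → ℂ} {w}, DifferentiableAt ℂ f w → DifferentiableAt ℝ f w :=
    fun h => h.restrictScalars ℝ
  have h0 : dzbar l (fun w => (starRingEnd ℂ) (f w)) =ᶠ[𝓝 z]
      fun w => (starRingEnd ℂ) (fderiv ℂ f w (Pi.single l 1)) := by
    filter_upwards [hf] with w hw
    rw [dzbar_conj (hR hw), dz_of_holomorphic hw]
  have h1 : DifferentiableAt ℂ (fun w => fderiv ℂ f w (Pi.single l 1)) z :=
    (differentiableOn_fderiv_apply hd hso _).differentiableAt (hso.mem_nhds hzs)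
  have hz := hf.self_of_nhds
  exact ⟨Complex.conjCLE.contDiff.contDiffAt.comp z (of_holomorphic (k := k) (l := l) hf).smooth,
    rfl, by rw [dz_conj (hR hz), dzbar_of_holomorphic hz, map_zero],
    by rw [dzbar_conj (hR hz), dz_of_holomorphic hz],
    by rw [dz_congr h0, dz_conj (hR h1), dzbar_of_holomorphic h1, map_zero]⟩

end HasJet

/-- The entries of the matrix-valued function `f` have the jets given by the entries of `a`, `b`,
`c`, `d`. -/
def HasMatJet (k l : Fin 7) (z : Fin 7 → ℂ) {m n : Type*} (f : (Fin 7 → ℂ) → Matrix m n ℂ)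
    (a b c d : Matrix m n ℂ) : Prop :=
  ∀ i j, HasJet k l z (fun w => f w i j) (a i j) (b i j) (c i j) (d i j)

namespace HasMatJet

variable {k l : Fin 7} {z : Fin 7 → ℂ} {m n p : Type*}

lemma const (x : Matrix m n ℂ) : HasMatJet k l z (fun _ => x) x 0 0 0 :=
  fun i j => HasJet.const (x i j)

lemma add {f g : (Fin 7 → ℂ) → Matrix m n ℂ} {a b c d a' b' c' d' : Matrix m n ℂ}
    (hf : HasMatJet k l z f a b c d) (hg : HasMatJet k l z g a' b' c' d') :
    HasMatJet k l z (fun w => f w + g w) (a + a') (b + b') (c + c') (d + d') :=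
  fun i j => (hf i j).add (hg i j)

lemma neg {f : (Fin 7 → ℂ) → Matrix m n ℂ} {a b c d : Matrix m n ℂ}
    (hf : HasMatJet k l z f a b c d) : HasMatJet k l z (fun w => -f w) (-a) (-b) (-c) (-d) :=
  fun i j => by simpa using (HasJet.const (-1)).mul (hf i j)

lemma sub {f g : (Fin 7 → ℂ) → Matrix m n ℂ} {a b c d a' b' c' d' : Matrix m n ℂ}
    (hf : HasMatJet k l z f a b c d) (hg : HasMatJet k l z g a' b' c' d') :
    HasMatJet k l z (fun w => f w - g w) (a - a') (b - b') (c - c') (d - d') := by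
  simpa only [sub_eq_add_neg] using hf.add hg.neg

lemma mul [Fintype n] {f : (Fin 7 → ℂ) → Matrix m n ℂ} {g : (Fin 7 → ℂ) → Matrix n p ℂ}
    {a b c d : Matrix m n ℂ} {a' b' c' d' : Matrix n p ℂ}
    (hf : HasMatJet k l z f a b c d) (hg : HasMatJet k l z g a' b' c' d') :
    HasMatJet k l z (fun w => f w * g w) (a * a') (b * a' + a * b') (c * a' + a * c')
      (d * a' + c * b' + b * c' + a * d') := fun i j => by
  simpa only [Matrix.add_apply, Matrix.mul_apply, Finset.sum_add_distrib] using
    HasJet.sum Finset.univ fun x => (hf i x).mul (hg x j)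

lemma trace [Fintype n] {f : (Fin 7 → ℂ) → Matrix n n ℂ} {a b c d : Matrix n n ℂ}
    (hf : HasMatJet k l z f a b c d) :
    HasJet k l z (fun w => (f w).trace) a.trace b.trace c.trace d.trace :=
  HasJet.sum Finset.univ fun i => hf i i

lemma congr {f g : (Fin 7 → ℂ) → Matrix m n ℂ} {a b c d : Matrix m n ℂ}
    (hf : HasMatJet k l z f a b c d) (h : g =ᶠ[𝓝 z] f) : HasMatJet k l z g a b c d :=
  fun i j => (hf i j).congr (by filter_upwards [h] with w hw; rw [hw])

end HasMatJet

/-! ### Root spaces in coordinates -/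

/-- The weight of the `i`-th coordinate vector, in coordinates with respect to the simple roots. -/
def weight : Fin 7 → Fin 3 → ℤ :=
  ![![1, 1, 1], ![0, 1, 1], ![0, 0, 1], ![0, 0, 0], ![0, 0, -1], ![0, -1, -1], ![-1, -1, -1]]

lemma weight_rev : ∀ i, weight i.rev = -weight i := by decide

lemma weight_injective : Function.Injective weight := by decide

/-- The coefficients of a root all have one sign. This is how a positive coefficient of `α₂` alone
gives the positivity that `gradedRoots` requires. -/
lemma weight_sub_nonneg : ∀ i j, 0 < (weight i - weight j) 1 → ∀ r, 0 ≤ (weight i - weight j) r := by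
  decide

/-- The diagonal matrix on which the simple roots take the values `a`. -/
def cartanElement (a : Fin 3 → ℂ) : Mat := Matrix.diagonal fun i => ∑ r, (weight i r : ℂ) * a r

lemma cartanElement_mem (a : Fin 3 → ℂ) : cartanElement a ∈ cartan := by
  refine ⟨fun i j => ?_, fun i j h => Matrix.diagonal_apply_ne _ h⟩
  by_cases h : i = j
  · subst h
    simp only [cartanElement, Matrix.diagonal_apply_eq, weight_rev, Pi.neg_apply, Int.cast_neg,
      neg_mul, Finset.sum_neg_distrib, neg_neg]
  · rw [cartanElement, Matrix.diagonal_apply_ne _ h, Matrix.diagonal_apply_ne _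
      fun h' => h (Fin.rev_injective h').symm, neg_zero]

lemma simpleRoot_cartanElement (a : Fin 3 → ℂ) : simpleRoot (cartanElement a) = a := by
  ext r
  fin_cases r <;> simp [simpleRoot, cartanElement, weight, Fin.sum_univ_three]

lemma diag_of_mem_cartan {H : Mat} (hH : H ∈ cartan) (i : Fin 7) :
    H i i = ∑ r, (weight i r : ℂ) * simpleRoot H r := by
  have h3 : H 3 3 = 0 := self_eq_neg.1 (hH.1 3 3)
  have h4 : H 4 4 = -H 2 2 := hH.1 4 4
  have h5 : H 5 5 = -H 1 1 := hH.1 5 5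
  have h6 : H 6 6 = -H 0 0 := hH.1 6 6
  fin_cases i <;> simp [simpleRoot, weight, Fin.sum_univ_three, h3, h4, h5, h6] <;> ring

lemma commutator_apply_of_mem_cartan {H : Mat} (hH : H ∈ cartan) (X : Mat) (i j : Fin 7) :
    (H * X - X * H) i j = (H i i - H j j) * X i j := by
  have h : H = Matrix.diagonal fun i => H i i := by
    ext a b
    by_cases hab : a = b
    · subst hab; simp
    · rw [Matrix.diagonal_apply_ne _ hab, hH.2 a b hab]
  have h1 : (H * X) i j = H i i * X i j := by
    conv_lhs => rw [h]
    rw [Matrix.diagonal_mul]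
  have h2 : (X * H) i j = X i j * H j j := by
    conv_lhs => rw [h]
    rw [Matrix.mul_diagonal]
  rw [Matrix.sub_apply, h1, h2]; ring

/-- Bracketing with a diagonal `H` multiplies the entry `(i, j)` by `H i i - H j j`. The elements of
`𝔥` dual to the simple roots then read off the coefficients of `n` one at a time. -/
lemma mem_rootSpace_iff {n : Fin 3 → ℤ} {X : Mat} :
    X ∈ rootSpace n ↔ X ∈ so7 ∧ ∀ i j, X i j ≠ 0 → n = weight i - weight j := by
  refine and_congr_right fun _ => ⟨fun h i j hij => ?_, fun h H hH => ?_⟩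
  · ext r
    have h1 := congrFun₂ (h _ (cartanElement_mem (Pi.single r 1))) i j
    rw [commutator_apply_of_mem_cartan (cartanElement_mem _), diag_of_mem_cartan (cartanElement_mem _),
      diag_of_mem_cartan (cartanElement_mem _), simpleRoot_cartanElement, Matrix.smul_apply,
      smul_eq_mul] at h1
    have h2 := mul_right_cancel₀ hij h1
    simp only [Pi.single_apply, mul_ite, mul_one, mul_zero, Finset.sum_ite_eq', Finset.mem_univ,
      if_true] at h2
    rw [Pi.sub_apply]
    exact_mod_cast h2.symm
  · ext i j
    rw [commutator_apply_of_mem_cartan hH, Matrix.smul_apply, smul_eq_mul]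
    by_cases hij : X i j = 0
    · rw [hij, mul_zero, mul_zero]
    · rw [h i j hij, diag_of_mem_cartan hH, diag_of_mem_cartan hH, ← Finset.sum_sub_distrib]
      congr 1
      refine Finset.sum_congr rfl fun r _ => ?_
      push_cast [Pi.sub_apply]
      ring

/-- `c` times the matrix `F_{ij} = e_{ij} - e_{j'i'}`. -/
def skewUnit (i j : Fin 7) (c : ℂ) : Mat :=
  Matrix.single i j c - Matrix.single j.rev i.rev c

lemma skewUnit_mem_rootSpace (i j : Fin 7) (c : ℂ) :
    skewUnit i j c ∈ rootSpace (weight i - weight j) := by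
  rw [mem_rootSpace_iff]
  refine ⟨fun a b => ?_, fun a b hab => ?_⟩
  · simp only [skewUnit, Matrix.sub_apply, Matrix.single_apply, Fin.rev_inj, neg_sub]
    congr 2 <;> grind [Fin.rev_rev]
  · simp only [skewUnit, Matrix.sub_apply, Matrix.single_apply] at hab
    by_cases h1 : i = a ∧ j = b
    · rw [h1.1, h1.2]
    · by_cases h2 : j.rev = a ∧ i.rev = b
      · rw [← h2.1, ← h2.2, weight_rev, weight_rev]; abel
      · simp [h1, h2] at hab

/-- The sum over all positions produces `X` twice, once from the entries themselves and once from
their reflections in the antidiagonal. -/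
lemma eq_sum_skewUnit {X : Mat} (hX : X ∈ so7) :
    X = (2⁻¹ : ℂ) • ∑ i, ∑ j, skewUnit i j (X i j) := by
  have h1 : ∑ i, ∑ j, Matrix.single i j (X i j) = X := (Matrix.matrix_eq_sum_single X).symm
  have h2 : ∑ i, ∑ j, Matrix.single j.rev i.rev (X i j) = -X := by
    conv_rhs => rw [Matrix.matrix_eq_sum_single X, ← Finset.sum_neg_distrib]
    rw [Finset.sum_comm, ← Equiv.sum_comp Fin.revPerm]
    refine Finset.sum_congr rfl fun i _ => ?_
    rw [← Equiv.sum_comp Fin.revPerm, ← Finset.sum_neg_distrib]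
    refine Finset.sum_congr rfl fun j _ => ?_
    simp only [Fin.revPerm_apply, Fin.rev_rev]
    rw [hX i j, Matrix.single_neg, neg_neg]
  simp only [skewUnit, Finset.sum_sub_distrib]
  rw [h1, h2, sub_neg_eq_add, ← two_smul ℂ X, smul_smul]
  norm_num

lemma rootSpace_ne_bot {X : Mat} (hX : X ∈ so7) {i j : Fin 7} (hij : X i j ≠ 0) :
    rootSpace (weight i - weight j) ≠ ⊥ := by
  intro h
  have h1 := skewUnit_mem_rootSpace i j 1
  rw [h, Submodule.mem_bot] at h1
  have h2 := congrFun₂ h1 i j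
  by_cases h3 : j.rev = i
  · apply hij
    have h4 := hX i j
    rw [h3, show i.rev = j by rw [← h3, Fin.rev_rev]] at h4
    exact self_eq_neg.1 h4
  · simp [skewUnit, h3] at h2

lemma mem_iSup_rootSpace {S : Set (Fin 3 → ℤ)} {X : Mat} (hX : X ∈ so7)
    (h : ∀ i j, X i j ≠ 0 → weight i - weight j ∈ S) : X ∈ ⨆ n ∈ S, rootSpace n := by
  rw [eq_sum_skewUnit hX]
  refine Submodule.smul_mem _ _ (Submodule.sum_mem _ fun i _ => Submodule.sum_mem _ fun j _ => ?_)
  by_cases hij : X i j = 0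
  · rw [hij]
    simp [skewUnit]
  · exact Submodule.mem_iSup_of_mem _ (Submodule.mem_iSup_of_mem (h i j hij)
      (skewUnit_mem_rootSpace i j _))

/-- The coefficient of `α₂` in the weight of the `i`-th coordinate vector. -/
def grade (i : Fin 7) : ℤ := weight i 1

lemma grade_rev (i : Fin 7) : grade i.rev = -grade i := by rw [grade, weight_rev]; rfl

/-- The matrices in `𝔰𝔬₇(ℂ)` whose nonzero entries have `grade i - grade j` in `S`. -/
def gradedPart (S : Set ℤ) : Submodule ℂ Mat where
  carrier := {X | X ∈ so7 ∧ ∀ i j, grade i - grade j ∉ S → X i j = 0}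
  add_mem' {X Y} hX hY := ⟨so7.add_mem hX.1 hY.1, fun i j h => by
    rw [Matrix.add_apply, hX.2 i j h, hY.2 i j h, add_zero]⟩
  zero_mem' := ⟨so7.zero_mem, fun i j _ => rfl⟩
  smul_mem' c X hX := ⟨so7.smul_mem c hX.1, fun i j h => by
    rw [Matrix.smul_apply, hX.2 i j h, smul_zero]⟩

lemma rootSpace_le_gradedPart {n : Fin 3 → ℤ} {S : Set ℤ} (hn : n 1 ∈ S) :
    rootSpace n ≤ gradedPart S := fun X hX => by
  rw [mem_rootSpace_iff] at hX
  refine ⟨hX.1, fun i j hij => ?_⟩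
  by_contra h0
  rw [hX.2 i j h0] at hn
  exact hij hn

/-- Only the coefficient of `α₂` matters, and it is a difference of two grades. This replaces sums
of root spaces by a vanishing condition on matrix entries. -/
lemma mPlus_eq {k : ℕ} (hk : 0 < k) : mPlus k = gradedPart {(k : ℤ)} := by
  apply le_antisymm
  · exact iSup₂_le fun n hn => rootSpace_le_gradedPart hn.2
  · intro X hX
    refine mem_iSup_rootSpace hX.1 fun i j hij => ?_
    have hg : (weight i - weight j) 1 = k := by
      by_contra h
      exact hij (hX.2 i j h)
    refine ⟨⟨⟨fun h => ?_, rootSpace_ne_bot hX.1 hij⟩, weight_sub_nonneg i j (by omega)⟩, hg⟩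
    rw [h] at hg
    simp at hg
    omega

/-- The grades along the basis are `1, 1, 0, 0, 0, -1, -1`, so `𝔭` becomes the block lower
triangular part of `𝔰𝔬₇(ℂ)`, with blocks of sizes 2, 3, 2. -/
lemma parabolicAlgebra_eq : parabolicAlgebra = gradedPart (Set.Iic 0) := by
  apply le_antisymm
  · refine sup_le (fun X hX => ⟨hX.1, fun i j hij => hX.2 i j ?_⟩) (iSup₂_le fun n hn => ?_)
    · rintro rfl
      simp at hij
    · by_cases h : n 1 ≤ 0
      · exact rootSpace_le_gradedPart h
      -- A root with positive coefficient of `α₂` is positive, hence lies in `Δ₂⁺(k)` for `k = n 1`,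
      -- which has been removed.
      · exfalso
        obtain ⟨X, hX, hX0⟩ := Submodule.exists_mem_ne_zero_of_ne_bot hn.1.2
        rw [mem_rootSpace_iff] at hX
        obtain ⟨i, j, hij⟩ : ∃ i j, X i j ≠ 0 := by
          by_contra! h'
          exact hX0 (Matrix.ext h')
        have hn' := hX.2 i j hij
        refine hn.2 (Set.mem_biUnion (x := (n 1).toNat) ?_ ⟨⟨hn.1, ?_⟩, ?_⟩)
        · rw [Set.mem_Ioi]; omega
        · rw [hn'] at h ⊢
          exact weight_sub_nonneg i j (by omega)
        · omega
  · intro X hX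
    have hd : Matrix.diagonal X.diag ∈ cartan := by
      refine ⟨fun i j => ?_, fun i j h => Matrix.diagonal_apply_ne _ h⟩
      by_cases h : i = j
      · subst h
        simpa using hX.1 i i
      · rw [Matrix.diagonal_apply_ne _ h, Matrix.diagonal_apply_ne _
          fun h' => h (Fin.rev_injective h').symm, neg_zero]
    rw [← add_sub_cancel (Matrix.diagonal X.diag) X]
    refine Submodule.add_mem_sup hd (mem_iSup_rootSpace (so7.sub_mem hX.1 hd.1) fun i j hij => ?_)
    have hne : i ≠ j := by
      rintro rfl
      simp at hij
    rw [Matrix.sub_apply, Matrix.diagonal_apply_ne _ hne, sub_zero] at hij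
    refine ⟨⟨sub_ne_zero.2 fun h => hne (weight_injective h), rootSpace_ne_bot hX.1 hij⟩, ?_⟩
    simp only [Set.mem_iUnion, not_exists]
    intro k hk hk'
    refine hij (hX.2 i j ?_)
    have : grade i - grade j = k := hk'.2
    rw [this, Set.mem_Iic]
    rw [Set.mem_Ioi] at hk
    omega

/-! ### The metric at the base point -/

/-- The part of `A` on the positions with `grade i - grade j = k`. -/
def homogeneousPart (k : ℤ) (A : Mat) : Mat :=
  Matrix.of fun i j => if grade i - grade j = k then A i j else 0

lemma homogeneousPart_mem {A : Mat} (hA : A ∈ so7) (k : ℤ) : homogeneousPart k A ∈ gradedPart {k} := by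
  refine ⟨fun i j => ?_, fun i j h => if_neg h⟩
  simp only [homogeneousPart, Matrix.of_apply, grade_rev]
  rw [hA i j, show -grade j - -grade i = grade i - grade j by ring]
  split_ifs <;> simp

lemma grade_sub_le : ∀ i j, grade i - grade j ≤ 2 := by decide

/-- The three summands of `𝔤` occupy disjoint sets of positions, so the decomposition exists and is
unique, and the value chosen by `Classical.epsilon` is forced. -/
lemma components_eq {A : Mat} (hA : A ∈ so7) :
    components A = (homogeneousPart 1 A, homogeneousPart 2 A) := by
  have hex : ∃ X : Mat × Mat,
      X.1 ∈ mPlus 1 ∧ X.2 ∈ mPlus 2 ∧ A - X.1 - X.2 ∈ parabolicAlgebra := by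
    refine ⟨(homogeneousPart 1 A, homogeneousPart 2 A), ?_, ?_, ?_⟩
    · rw [mPlus_eq one_pos]; exact homogeneousPart_mem hA 1
    · rw [mPlus_eq two_pos]; exact homogeneousPart_mem hA 2
    · rw [parabolicAlgebra_eq]
      refine ⟨so7.sub_mem (so7.sub_mem hA (homogeneousPart_mem hA 1).1)
        (homogeneousPart_mem hA 2).1, fun i j h => ?_⟩
      rw [Set.mem_Iic, not_le] at h
      have h2 := grade_sub_le i j
      obtain h1 | h1 : grade i - grade j = 1 ∨ grade i - grade j = 2 := by omega
      all_goals simp [homogeneousPart, h1]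
  have h := Classical.epsilon_spec hex
  change (components A).1 ∈ mPlus 1 ∧ (components A).2 ∈ mPlus 2 ∧
    A - (components A).1 - (components A).2 ∈ parabolicAlgebra at h
  rw [mPlus_eq one_pos, mPlus_eq two_pos, parabolicAlgebra_eq] at h
  obtain ⟨h1, h2, h3⟩ := h
  refine Prod.ext (Matrix.ext fun i j => ?_) (Matrix.ext fun i j => ?_)
  all_goals
    simp only [homogeneousPart, Matrix.of_apply]
    split_ifs with hij
  · have e2 := h2.2 i j (by simp [hij])
    have e3 := h3.2 i j (by simp [hij])
    rw [Matrix.sub_apply, Matrix.sub_apply, e2, sub_zero] at e3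
    exact (sub_eq_zero.1 e3).symm
  · exact h1.2 i j (by simpa using hij)
  · have e1 := h1.2 i j (by simp [hij])
    have e3 := h3.2 i j (by simp [hij])
    rw [Matrix.sub_apply, Matrix.sub_apply, e1, sub_zero] at e3
    exact (sub_eq_zero.1 e3).symm
  · exact h2.2 i j (by simpa using hij)

/-- The inclusion of the last two coordinates, which span the isotropic plane fixed by `P`. -/
def inclusion : Matrix (Fin 7) (Fin 2) ℂ := Matrix.of ![0, 0, 0, 0, 0, ![1, 0], ![0, 1]]

lemma inclusion_conjTranspose_mul : inclusionᴴ * inclusion = 1 := by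
  ext a b
  fin_cases a <;> fin_cases b <;>
    simp [inclusion, Matrix.mul_apply, Fin.sum_univ_seven]

lemma mul_inclusion_apply {n : Type*} (g : Matrix n (Fin 7) ℂ) (i : n) (m : Fin 2) :
    (g * inclusion) i m = g i (![5, 6] m) := by
  fin_cases m <;> simp [inclusion, Matrix.mul_apply, Fin.sum_univ_seven]

lemma inclusion_conjTranspose_mul_apply {n : Type*} (X : Matrix (Fin 7) n ℂ) (m : Fin 2) (j : n) :
    (inclusionᴴ * X) m j = X (![5, 6] m) j := by
  fin_cases m <;> simp [inclusion, Matrix.mul_apply, Fin.sum_univ_seven]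

lemma inclusion_mul_apply {n : Type*} (X : Matrix (Fin 2) n ℂ) (i : Fin 7) (j : n) :
    (inclusion * X) i j = (![0, 0, 0, 0, 0, X 0 j, X 1 j] : Fin 7 → ℂ) i := by
  fin_cases i <;> simp [inclusion, Matrix.mul_apply, Fin.sum_univ_two]

/-- The right side is the Hilbert–Schmidt product of the upper `5 × 2` blocks, that is, the
Grassmannian metric at the base plane. In grade 1 each of the entries in rows 2 to 4 occurs a second
time, up to sign, in rows 0 and 1, which cancels the `1/2` in `killing`; in grade 2 all entries are
already in the last two columns, and the weight 2 cancels it. -/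
lemma baseMetric_eq {A B : Mat} (hA : A ∈ so7) (hB : B ∈ so7) :
    baseMetric A B = ((B * inclusion)ᴴ * (1 - inclusion * inclusionᴴ) * (A * inclusion)).trace := by
  rw [baseMetric, components_eq hA, components_eq hB]
  have hR : ((B * inclusion)ᴴ * (1 - inclusion * inclusionᴴ) * (A * inclusion)).trace =
      ∑ m, ∑ i : Fin 7, (if (i : ℕ) < 5 then
        A i (![5, 6] m) * (starRingEnd ℂ) (B i (![5, 6] m)) else 0) := by
    rw [Matrix.mul_assoc, Matrix.sub_mul, Matrix.one_mul, Matrix.mul_assoc inclusion,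
      Matrix.trace]
    refine Finset.sum_congr rfl fun m _ => ?_
    rw [Matrix.diag_apply, Matrix.mul_apply]
    refine Finset.sum_congr rfl fun i _ => ?_
    rw [Matrix.conjTranspose_apply, Matrix.sub_apply, inclusion_mul_apply, mul_inclusion_apply,
      mul_inclusion_apply, inclusion_conjTranspose_mul_apply, inclusion_conjTranspose_mul_apply,
      mul_inclusion_apply, mul_inclusion_apply]
    fin_cases i <;> simp [mul_comm]
  have h : ∀ C D : Mat, (C * Dᴴ).trace = ∑ i, ∑ j, C i j * (starRingEnd ℂ) (D i j) := by
    intro C D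
    simp [Matrix.trace, Matrix.mul_apply]
  rw [hR]
  simp only [killing, conjugation, Matrix.mul_neg, Matrix.trace_neg, h, homogeneousPart,
    Matrix.of_apply]
  have a1 : A 0 2 = -A 4 6 := hA 0 2
  have a2 : A 0 3 = -A 3 6 := hA 0 3
  have a3 : A 0 4 = -A 2 6 := hA 0 4
  have a4 : A 1 2 = -A 4 5 := hA 1 2
  have a5 : A 1 3 = -A 3 5 := hA 1 3
  have a6 : A 1 4 = -A 2 5 := hA 1 4
  have b1 : B 0 2 = -B 4 6 := hB 0 2
  have b2 : B 0 3 = -B 3 6 := hB 0 3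
  have b3 : B 0 4 = -B 2 6 := hB 0 4
  have b4 : B 1 2 = -B 4 5 := hB 1 2
  have b5 : B 1 3 = -B 3 5 := hB 1 3
  have b6 : B 1 4 = -B 2 5 := hB 1 4
  simp [Fin.sum_univ_seven, Fin.sum_univ_two, grade, weight, a1, a2, a3, a4, a5, a6, b1, b2, b3,
    b4, b5, b6]
  ring

/-! ### The isotropic plane fixed by the parabolic subgroup -/

lemma toMat_mul (g h : SO7) : toMat (g * h) = toMat g * toMat h := by simp [toMat]

lemma toMat_mul_inv (g : SO7) : toMat g * toMat g⁻¹ = 1 := by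
  rw [← toMat_mul, mul_inv_cancel]; simp [toMat]

lemma toMat_inv_mul (g : SO7) : toMat g⁻¹ * toMat g = 1 := by
  rw [← toMat_mul, inv_mul_cancel]; simp [toMat]

lemma toMat_form (g : SO7) : (toMat g)ᵀ * formMatrix * toMat g = formMatrix := g.2

lemma eq_rev_comm {i j : Fin 7} : i = j.rev ↔ j = i.rev := by
  rw [← Fin.rev_eq_iff, eq_comm]

lemma formMatrix_mul_apply {n : Type*} (X : Matrix (Fin 7) n ℂ) (i : Fin 7) (j : n) :
    (formMatrix * X) i j = X i.rev j := by
  simp [formMatrix, Matrix.mul_apply]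

lemma mul_formMatrix_apply {n : Type*} (X : Matrix n (Fin 7) ℂ) (i : n) (j : Fin 7) :
    (X * formMatrix) i j = X i j.rev := by
  simp [formMatrix, Matrix.mul_apply, eq_rev_comm (i := j)]

lemma formMatrix_mul_self : formMatrix * formMatrix = 1 := by
  ext i j
  rw [formMatrix_mul_apply]
  simp [formMatrix, Matrix.one_apply, eq_comm]

lemma mem_so7_iff {X : Mat} : X ∈ so7 ↔ Xᵀ * formMatrix + formMatrix * X = 0 := by
  constructor
  · intro h
    ext i j
    rw [Matrix.add_apply, mul_formMatrix_apply, formMatrix_mul_apply, Matrix.transpose_apply,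
      h i.rev j, Fin.rev_rev]
    simp
  · intro h i j
    have h1 := congrFun₂ h i.rev j
    rw [Matrix.add_apply, mul_formMatrix_apply, formMatrix_mul_apply, Matrix.transpose_apply,
      Fin.rev_rev] at h1
    exact eq_neg_of_add_eq_zero_right h1

lemma toMat_inv (g : SO7) : toMat g⁻¹ = formMatrix * (toMat g)ᵀ * formMatrix := by
  have h : formMatrix * (toMat g)ᵀ * formMatrix * toMat g = 1 := by
    rw [Matrix.mul_assoc, Matrix.mul_assoc, ← Matrix.mul_assoc (toMat g)ᵀ, toMat_form,
      formMatrix_mul_self]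
  calc toMat g⁻¹ = formMatrix * (toMat g)ᵀ * formMatrix * toMat g * toMat g⁻¹ := by
        rw [h, Matrix.one_mul]
    _ = _ := by rw [Matrix.mul_assoc _ (toMat g), toMat_mul_inv, Matrix.mul_one]

lemma toMat_inv_apply (g : SO7) (i j : Fin 7) : toMat g⁻¹ i j = toMat g j.rev i.rev := by
  rw [toMat_inv, mul_formMatrix_apply, formMatrix_mul_apply, Matrix.transpose_apply]

lemma formMatrix_transpose : formMatrixᵀ = formMatrix := by
  ext i j
  simp [formMatrix, eq_rev_comm (i := i)]

lemma adjointAction_mem_so7 (g : SO7) {X : Mat} (hX : X ∈ so7) : adjointAction g X ∈ so7 := by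
  rw [mem_so7_iff] at hX ⊢
  have h1 : (toMat g)ᵀ * formMatrix = formMatrix * toMat g⁻¹ := by
    rw [toMat_inv, ← Matrix.mul_assoc, ← Matrix.mul_assoc, formMatrix_mul_self, Matrix.one_mul]
  have h2 : formMatrix * toMat g = (toMat g⁻¹)ᵀ * formMatrix := by
    rw [← Matrix.transpose_transpose (formMatrix * toMat g), Matrix.transpose_mul,
      formMatrix_transpose, h1, Matrix.transpose_mul, formMatrix_transpose]
  calc (adjointAction g X)ᵀ * formMatrix + formMatrix * adjointAction g X
      = (toMat g⁻¹)ᵀ * Xᵀ * ((toMat g)ᵀ * formMatrix)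
          + (formMatrix * toMat g) * X * toMat g⁻¹ := by
        simp only [adjointAction, Matrix.transpose_mul, Matrix.mul_assoc]
    _ = (toMat g⁻¹)ᵀ * (Xᵀ * formMatrix + formMatrix * X) * toMat g⁻¹ := by
        rw [h1, h2]
        simp only [Matrix.mul_assoc, Matrix.mul_add, Matrix.add_mul]
    _ = 0 := by rw [hX, Matrix.mul_zero, Matrix.zero_mul]

lemma mul_single_mul_apply (A B : Mat) (i j a b : Fin 7) :
    (A * (Matrix.single i j 1 : Mat) * B) a b = A a i * B j b := by
  simp [Matrix.mul_apply, Matrix.single_apply, ite_and]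

/-- The entries of `g⁻¹ F g`, for the element `F` of `𝔭` supported at `(m.rev, l)` and its mirror
position, are `2 × 2` minors of `g`, because inverting `g` reflects it in the antidiagonal.
Membership in `𝔭` makes those of positive grade vanish. -/
lemma minor_eq_zero_of_mem_parabolic {g : SO7} (hg : g ∈ parabolic) {m l a b : Fin 7}
    (hml : 0 ≤ grade m + grade l) (hab : grade a + grade b < 0) :
    toMat g m a * toMat g l b = toMat g l a * toMat g m b := by
  have hX : skewUnit m.rev l 1 ∈ parabolicAlgebra := by
    rw [parabolicAlgebra_eq]
    refine rootSpace_le_gradedPart ?_ (skewUnit_mem_rootSpace m.rev l 1)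
    change grade m.rev - grade l ∈ Set.Iic 0
    rw [grade_rev, Set.mem_Iic]
    linarith
  have h := (parabolic.inv_mem hg _).2 hX
  rw [parabolicAlgebra_eq] at h
  have h1 := h.2 a.rev b (by rw [grade_rev, Set.mem_Iic]; linarith)
  rw [adjointAction, inv_inv, skewUnit, Matrix.mul_sub, Matrix.sub_mul, Matrix.sub_apply,
    mul_single_mul_apply, mul_single_mul_apply, toMat_inv_apply, toMat_inv_apply, Fin.rev_rev,
    Fin.rev_rev, Fin.rev_rev] at h1
  exact sub_eq_zero.1 h1

/-- If `g m b ≠ 0`, the vanishing minors make the rows of `g` of nonnegative grade proportional to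
row `m` on the columns `a` with `grade a + grade b < 0`. The rank of `g` then drops, contradicting
invertibility. -/
lemma apply_eq_zero_of_mem_parabolic {g : SO7} (hg : g ∈ parabolic) {m b : Fin 7}
    (hm : 0 ≤ grade m) (hb : grade b < 0) : toMat g m b = 0 := by
  by_contra hmb
  -- Five conditions on `ℂ⁷` leave a nonzero `v`. The first two kill the columns of grade 1, to
  -- which the minor relation does not apply; the others kill row `m` and the two rows of negative
  -- grade in `g v`. Proportionality then gives `g v = 0`.
  let f : (Fin 7 → ℂ) →ₗ[ℂ] (Fin 5 → ℂ) := LinearMap.pi ![LinearMap.proj 0, LinearMap.proj 1,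
    LinearMap.proj m ∘ₗ (toMat g).mulVecLin, LinearMap.proj 5 ∘ₗ (toMat g).mulVecLin,
    LinearMap.proj 6 ∘ₗ (toMat g).mulVecLin]
  obtain ⟨v, hv, hv0⟩ := Submodule.exists_mem_ne_zero_of_ne_bot
    (LinearMap.ker_ne_bot_of_finrank_lt (f := f) (by simp))
  rw [LinearMap.mem_ker] at hv
  have e0 : v 0 = 0 := congrFun hv 0
  have e1 : v 1 = 0 := congrFun hv 1
  have em : (toMat g *ᵥ v) m = 0 := congrFun hv 2
  have e5 : (toMat g *ᵥ v) 5 = 0 := congrFun hv 3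
  have e6 : (toMat g *ᵥ v) 6 = 0 := congrFun hv 4
  have hva : ∀ a, grade a + grade b < 0 ∨ v a = 0 := by
    intro a
    by_cases ha : grade a ≤ 0
    · left; linarith
    · right
      have : ∀ a, grade a ≤ 0 ∨ a = 0 ∨ a = 1 := by decide
      rcases this a with h | rfl | rfl
      · exact absurd h ha
      · exact e0
      · exact e1
  have key : toMat g *ᵥ v = 0 := by
    ext l
    have : ∀ l, 0 ≤ grade l ∨ l = 5 ∨ l = 6 := by decide
    rcases this l with h | rfl | rfl
    · have h2 : (toMat g *ᵥ v) m * toMat g l b = (toMat g *ᵥ v) l * toMat g m b := by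
        simp only [Matrix.mulVec, dotProduct, Finset.sum_mul]
        refine Finset.sum_congr rfl fun a _ => ?_
        rcases hva a with ha | ha
        · have := minor_eq_zero_of_mem_parabolic hg (m := m) (l := l) (by linarith) ha
          linear_combination v a * this
        · rw [ha]; ring
      rw [em, zero_mul] at h2
      exact (mul_eq_zero.1 h2.symm).resolve_right hmb
    · exact e5
    · exact e6
  apply hv0
  rw [← Matrix.one_mulVec v, ← toMat_inv_mul g, ← Matrix.mulVec_mulVec, key, Matrix.mulVec_zero]

/-- The span of the last two basis vectors is stable under `P`, so a coset `gP` determines an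
isotropic plane. -/
lemma toMat_mul_inclusion_of_mem_parabolic {g : SO7} (hg : g ∈ parabolic) :
    toMat g * inclusion = inclusion * (inclusionᴴ * (toMat g * inclusion)) := by
  ext i m
  have hb : ∀ m : Fin 2, grade (![5, 6] m) < 0 := by decide
  have hi : ∀ i, 0 ≤ grade i ∨ i = 5 ∨ i = 6 := by decide
  rw [inclusion_mul_apply, inclusion_conjTranspose_mul_apply, inclusion_conjTranspose_mul_apply]
  rcases hi i with h | rfl | rfl
  · rw [mul_inclusion_apply, apply_eq_zero_of_mem_parabolic hg h (hb m)]
    have hi' : ∀ i, 0 ≤ grade i → i = 0 ∨ i = 1 ∨ i = 2 ∨ i = 3 ∨ i = 4 := by decide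
    rcases hi' i h with rfl | rfl | rfl | rfl | rfl <;> rfl
  · rfl
  · rfl

lemma mul_apply_eq_zero_of_grade {A B : Mat} (hA : ∀ i j, grade j < grade i → A i j = 0)
    (hB : ∀ i j, grade j < grade i → B i j = 0) (i j : Fin 7) (h : grade j < grade i) :
    (A * B) i j = 0 := by
  rw [Matrix.mul_apply]
  refine Finset.sum_eq_zero fun k _ => ?_
  by_cases hk : grade k < grade i
  · rw [hA i k hk, zero_mul]
  · rw [hB k j (by linarith), mul_zero]

/-- Block lower triangular matrices are closed under products, and the reflection in the
antidiagonal that inverts `g` preserves their shape; so `g` and `g⁻¹` both map `𝔭` into itself. -/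
lemma mem_parabolic_of_grade {g : SO7} (hg : ∀ i j, grade j < grade i → toMat g i j = 0) :
    g ∈ parabolic := by
  have hg' : ∀ i j, grade j < grade i → toMat g⁻¹ i j = 0 := fun i j h => by
    rw [toMat_inv_apply]
    exact hg _ _ (by rw [grade_rev, grade_rev]; linarith)
  have key : ∀ g : SO7, (∀ i j, grade j < grade i → toMat g i j = 0) →
      (∀ i j, grade j < grade i → toMat g⁻¹ i j = 0) →
      ∀ X ∈ parabolicAlgebra, adjointAction g X ∈ parabolicAlgebra := by
    intro g h h' X hX
    rw [parabolicAlgebra_eq] at hX ⊢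
    refine ⟨adjointAction_mem_so7 g hX.1, fun i j hij => ?_⟩
    refine mul_apply_eq_zero_of_grade (mul_apply_eq_zero_of_grade h fun i j hij => hX.2 i j ?_) h'
      i j ?_
    · rw [Set.mem_Iic]; linarith
    · rw [Set.mem_Iic] at hij; linarith
  intro X
  refine ⟨fun h => ?_, key g hg hg' X⟩
  have := key g⁻¹ hg' (by rwa [inv_inv]) _ h
  rwa [← adjointAction_mul, inv_mul_cancel, adjointAction_one] at this

/-! ### Transitivity of the compact real form -/

/-! ### Triangular matrices and the QR decomposition -/

section Triangular

variable {n : Type*} [Fintype n] [LinearOrder n]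

lemma lower_inv {b : Matrix n n ℂ} (hb : ∀ i j, i < j → b i j = 0) (hdet : IsUnit b.det) :
    ∀ i j, i < j → b⁻¹ i j = 0 := by
  have h : b.BlockTriangular OrderDual.toDual := fun i j hij => hb i j hij
  have := b.invertibleOfIsUnitDet hdet
  exact fun i j hij => Matrix.blockTriangular_inv_of_blockTriangular h hij

lemma lower_mul_diag {a b : Matrix n n ℂ} (ha : ∀ i j, i < j → a i j = 0)
    (hb : ∀ i j, i < j → b i j = 0) (i : n) : (a * b) i i = a i i * b i i := by
  rw [Matrix.mul_apply, Finset.sum_eq_single i]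
  · intro k _ hk
    rcases lt_or_gt_of_ne hk with h | h
    · rw [hb k i h, mul_zero]
    · rw [ha i k h, zero_mul]
  · simp

lemma lower_mul {a b : Matrix n n ℂ} (ha : ∀ i j, i < j → a i j = 0)
    (hb : ∀ i j, i < j → b i j = 0) : ∀ i j, i < j → (a * b) i j = 0 := by
  intro i j hij
  rw [Matrix.mul_apply]
  refine Finset.sum_eq_zero fun k _ => ?_
  by_cases hk : i < k
  · rw [ha i k hk, zero_mul]
  · rw [hb k j ((not_lt.1 hk).trans_lt hij), mul_zero]

/-- The inverse is lower triangular and equals the conjugate transpose, which forces `t` to be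
diagonal; a positive number of absolute value one is one. -/
lemma eq_one_of_lower_of_unitary {t : Matrix n n ℂ} (ht : ∀ i j, i < j → t i j = 0)
    (hpos : ∀ i, ∃ r : ℝ, 0 < r ∧ t i i = r) (hu : tᴴ * t = 1) : t = 1 := by
  have hinv : t⁻¹ = tᴴ := Matrix.inv_eq_left_inv hu
  have hl := lower_inv ht (Matrix.isUnit_det_of_left_inverse hu)
  rw [hinv] at hl
  have hoff : ∀ i j, i ≠ j → t i j = 0 := fun i j hij => by
    rcases lt_or_gt_of_ne hij with h | h
    · exact ht i j h
    · simpa using hl j i h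
  ext i j
  by_cases hij : i = j
  · subst hij
    obtain ⟨r, hr, hri⟩ := hpos i
    have h1 := congrFun₂ hu i i
    rw [Matrix.mul_apply, Finset.sum_eq_single i, Matrix.conjTranspose_apply, hri,
      Matrix.one_apply_eq] at h1
    · have h2 : r * r = 1 := by
        have : ((r * r : ℝ) : ℂ) = (1 : ℝ) := by simpa using h1
        exact_mod_cast this
      have h3 : r = 1 := by nlinarith
      rw [hri, h3, Matrix.one_apply_eq, Complex.ofReal_one]
    · intro k _ hk
      rw [hoff k i hk, mul_zero]
    · simp
  · rw [hoff i j hij, Matrix.one_apply_ne hij]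

open scoped ComplexOrder in
/-- The `QR` decomposition, with a lower triangular factor. -/
lemma exists_lower_mul_unitary [LocallyFiniteOrderBot n] {g : Matrix n n ℂ} (hg : IsUnit g.det) :
    ∃ b : Matrix n n ℂ, (∀ i j, i < j → b i j = 0) ∧ (∀ i, ∃ r : ℝ, 0 < r ∧ b i i = r) ∧
      (g * b)ᴴ * (g * b) = 1 := by
  have hgu : IsUnit g := (Matrix.isUnit_iff_isUnit_det g).2 hg
  have hP : (gᴴ * g).PosDef := Matrix.PosDef.conjTranspose_mul_self g
    (Matrix.mulVec_injective_iff_isUnit.2 hgu)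
  -- Diagonalising `(gᴴ g)⁻¹` as `L (gᴴ g)⁻¹ Lᴴ` makes `(L⁻¹)ᴴ (gᴴ g) L⁻¹` diagonal too, so the
  -- columns of `g L⁻¹` are orthogonal and `L⁻¹` is lower triangular as wanted.
  have hS := hP.inv
  set L := LDL.lowerInv hS with hL
  have hLtri : ∀ i j, i < j → L i j = 0 := fun i j h => LDL.lowerInv_triangular hS h
  have hLu : IsUnit L.det := by
    have : Invertible L := LDL.invertibleLowerInv hS
    exact Matrix.isUnit_det_of_invertible L
  have hD : LDL.diag hS = L * (gᴴ * g)⁻¹ * Lᴴ := LDL.diag_eq_lowerInv_conj hS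
  have hDpos : (LDL.diag hS).PosDef := by
    rw [hD]
    exact hS.mul_mul_conjTranspose_same (Matrix.vecMul_injective_iff_isUnit.2
      ((Matrix.isUnit_iff_isUnit_det L).2 hLu))
  have hd : ∀ i, ∃ r : ℝ, 0 < r ∧ LDL.diagEntries hS i = r := fun i => by
    have h := hDpos.diag_pos (i := i)
    rw [LDL.diag, Matrix.diagonal_apply_eq] at h
    exact ⟨_, (Complex.pos_iff.1 h).1, Complex.ext rfl (Complex.pos_iff.1 h).2.symm⟩
  choose r hr hrd using hd
  have hLinv := lower_inv hLtri hLu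
  have hx : ∀ i, L⁻¹ i i ≠ 0 := fun i h0 => by
    have h1 := lower_mul_diag hLtri hLinv i
    rw [Matrix.mul_nonsing_inv L hLu, h0, mul_zero, Matrix.one_apply_eq] at h1
    exact one_ne_zero h1
  -- The square root normalises the columns of `g L⁻¹`, whose squared lengths are `1 / r i`; the
  -- phase makes the diagonal of the triangular factor positive.
  set d : n → ℂ := fun i => Real.sqrt (r i) * ((starRingEnd ℂ) (L⁻¹ i i) / ‖L⁻¹ i i‖) with hdd
  refine ⟨L⁻¹ * Matrix.diagonal d, fun i j hij => ?_, fun i => ?_, ?_⟩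
  · rw [Matrix.mul_diagonal, hLinv i j hij, zero_mul]
  · refine ⟨Real.sqrt (r i) * ‖L⁻¹ i i‖, mul_pos (Real.sqrt_pos.2 (hr i)) (norm_pos_iff.2 (hx i)), ?_⟩
    have hn : (‖L⁻¹ i i‖ : ℂ) ≠ 0 := by simpa using hx i
    rw [Matrix.mul_diagonal, hdd]
    have := Complex.mul_conj' (L⁻¹ i i)
    push_cast
    field_simp
    linear_combination (Real.sqrt (r i) : ℂ) * this
  · have hDD : (Matrix.diagonal d)ᴴ * (LDL.diag hS)⁻¹ * Matrix.diagonal d = 1 := by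
      have h1 : (LDL.diag hS)⁻¹ = Matrix.diagonal fun i => (r i : ℂ)⁻¹ := by
        apply Matrix.inv_eq_left_inv
        rw [LDL.diag, Matrix.diagonal_mul_diagonal, ← Matrix.diagonal_one]
        congr 1
        ext i
        rw [hrd]
        exact inv_mul_cancel₀ (by exact_mod_cast (hr i).ne')
      rw [h1, Matrix.diagonal_conjTranspose, Matrix.diagonal_mul_diagonal,
        Matrix.diagonal_mul_diagonal, ← Matrix.diagonal_one]
      congr 1
      ext i
      have hn : (‖L⁻¹ i i‖ : ℂ) ≠ 0 := by simpa using hx i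
      have hr' : (r i : ℂ) ≠ 0 := by exact_mod_cast (hr i).ne'
      have hs : (Real.sqrt (r i) : ℂ) ^ 2 = r i := by exact_mod_cast Real.sq_sqrt (hr i).le
      have := Complex.mul_conj' (L⁻¹ i i)
      simp only [hdd, Pi.star_apply, star_mul', star_div₀, RCLike.star_def, Complex.conj_ofReal,
        Complex.conj_conj]
      field_simp
      rw [hs]
      linear_combination (r i : ℂ) * this
    have hDi : (LDL.diag hS)⁻¹ = (L⁻¹)ᴴ * (gᴴ * g) * L⁻¹ := by
      rw [hD, Matrix.mul_inv_rev, Matrix.mul_inv_rev,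
        Matrix.nonsing_inv_nonsing_inv _ ((Matrix.isUnit_iff_isUnit_det _).1 hP.isUnit),
        Matrix.conjTranspose_nonsing_inv]
      simp only [Matrix.mul_assoc]
    rw [hDi] at hDD
    rw [← hDD]
    simp only [Matrix.conjTranspose_mul, Matrix.mul_assoc]

end Triangular

/-- Transitivity of the compact form, by the QR decomposition `u = g b`: the factor `u⁻¹ g = b⁻¹` is
lower triangular, hence in `P`. It has to be shown that the unitary `u` is again orthogonal of
determinant one. -/
lemma exists_compactForm (x : Space) :
    ∃ u : SO7, u ∈ compactForm ∧ (QuotientGroup.mk u : Space) = x := by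
  obtain ⟨g, rfl⟩ := QuotientGroup.mk_surjective x
  have hgdet : (toMat g).det = 1 := g.1.2
  obtain ⟨b, hb, hbpos, hu⟩ := exists_lower_mul_unitary (g := toMat g) (by rw [hgdet]; exact isUnit_one)
  set u : Mat := toMat g * b with hudef
  have hbdet : b.det = ∏ i, b i i := Matrix.det_of_isLowerTriangular b fun i j h => hb i j h
  have hbpos' : ∃ r : ℝ, 0 < r ∧ b.det = r := by
    choose r hr hrb using hbpos
    exact ⟨∏ i, r i, Finset.prod_pos fun i _ => hr i, by rw [hbdet]; simp [hrb]⟩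
  have hbu : IsUnit b.det := by
    obtain ⟨r, hr, h⟩ := hbpos'
    rw [h]; exact (isUnit_iff_ne_zero.2 (by exact_mod_cast hr.ne'))
  set c := b⁻¹ with hc
  have hclow := lower_inv hb hbu
  have hcb : c * b = 1 := Matrix.nonsing_inv_mul b hbu
  have hbc : b * c = 1 := Matrix.mul_nonsing_inv b hbu
  have hcpos : ∀ i, ∃ r : ℝ, 0 < r ∧ c i i = r := fun i => by
    obtain ⟨r, hr, h⟩ := hbpos i
    have h1 := lower_mul_diag hclow hb i
    rw [← hc, hcb, Matrix.one_apply_eq, h] at h1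
    refine ⟨r⁻¹, inv_pos.2 hr, ?_⟩
    rw [Complex.ofReal_inv]
    exact eq_inv_of_mul_eq_one_left h1.symm
  -- the inverse of `u`
  have huinv : c * toMat g⁻¹ = uᴴ := by
    calc c * toMat g⁻¹ = (uᴴ * u) * (c * toMat g⁻¹) := by rw [hu, Matrix.one_mul]
      _ = uᴴ * (toMat g * (b * c) * toMat g⁻¹) := by simp only [hudef, Matrix.mul_assoc]
      _ = uᴴ := by rw [hbc, Matrix.mul_one, toMat_mul_inv, Matrix.mul_one]
  have huu : u * uᴴ = 1 := mul_eq_one_comm.1 hu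
  have hutu : uᵀ * (uᴴ)ᵀ = 1 := by rw [← Matrix.transpose_mul, hu, Matrix.transpose_one]
  -- With `F` the form matrix, `t` measures the failure of `u` to preserve the form. As `c (F cᵀ F)`
  -- it is lower triangular with positive diagonal; as `uᴴ (F (uᴴ)ᵀ F)` it is unitary because `g`
  -- preserves the form. So `t = 1`.
  set t := c * (formMatrix * cᵀ * formMatrix) with ht
  have htu : t = uᴴ * (formMatrix * (uᴴ)ᵀ * formMatrix) := by
    rw [← huinv, Matrix.transpose_mul, toMat_inv, Matrix.transpose_mul, Matrix.transpose_mul,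
      Matrix.transpose_transpose, formMatrix_transpose, ht]
    have h1 : toMat g⁻¹ * toMat g = 1 := toMat_inv_mul g
    rw [toMat_inv] at h1
    calc c * (formMatrix * cᵀ * formMatrix)
        = c * (formMatrix * (toMat g)ᵀ * formMatrix * toMat g)
            * (formMatrix * cᵀ * formMatrix) := by rw [h1, Matrix.mul_one]
      _ = c * (formMatrix * (toMat g)ᵀ * formMatrix) * (1 * toMat g * formMatrix * cᵀ * formMatrix)
          := by simp only [Matrix.one_mul, Matrix.mul_assoc]
      _ = _ := by rw [← formMatrix_mul_self]; simp only [Matrix.mul_assoc]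
  have ht1 : t = 1 := by
    have hsec : ∀ i j, (formMatrix * cᵀ * formMatrix) i j = c j.rev i.rev := fun i j => by
      rw [mul_formMatrix_apply, formMatrix_mul_apply, Matrix.transpose_apply]
    have hseclow : ∀ i j, i < j → (formMatrix * cᵀ * formMatrix) i j = 0 := fun i j hij => by
      rw [hsec]; exact hclow _ _ (Fin.rev_lt_rev.2 hij)
    refine eq_one_of_lower_of_unitary (lower_mul hclow hseclow) (fun i => ?_) ?_
    · obtain ⟨r, hr, h⟩ := hcpos i
      obtain ⟨r', hr', h'⟩ := hcpos i.rev
      refine ⟨r * r', mul_pos hr hr', (lower_mul_diag hclow hseclow i).trans ?_⟩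
      rw [hsec, ← hc, h, h', Complex.ofReal_mul]
    · have hFH : formMatrixᴴ = formMatrix := by
        ext i j
        simp [formMatrix, eq_rev_comm (i := i), apply_ite]
      rw [htu]
      have h2 : ((uᴴ)ᵀ)ᴴ * (uᴴ)ᵀ = 1 := by
        rw [← hutu]
        congr 1
        ext i j
        simp
      calc (uᴴ * (formMatrix * (uᴴ)ᵀ * formMatrix))ᴴ * (uᴴ * (formMatrix * (uᴴ)ᵀ * formMatrix))
          = formMatrix * ((uᴴ)ᵀ)ᴴ * formMatrix * (u * uᴴ) * formMatrix * (uᴴ)ᵀ * formMatrix := by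
            simp only [Matrix.conjTranspose_mul, hFH, Matrix.conjTranspose_conjTranspose,
              Matrix.mul_assoc]
        _ = formMatrix * ((uᴴ)ᵀ)ᴴ * (formMatrix * formMatrix) * (uᴴ)ᵀ * formMatrix := by
            rw [huu, Matrix.mul_one]; simp only [Matrix.mul_assoc]
        _ = formMatrix * (((uᴴ)ᵀ)ᴴ * (uᴴ)ᵀ) * formMatrix := by
            rw [formMatrix_mul_self, Matrix.mul_one]; simp only [Matrix.mul_assoc]
        _ = 1 := by rw [h2, Matrix.mul_one, formMatrix_mul_self]
  have hform : uᵀ * formMatrix * u = formMatrix := by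
    have h1 : u = formMatrix * (uᴴ)ᵀ * formMatrix := by
      calc u = u * t := by rw [ht1, Matrix.mul_one]
        _ = (u * uᴴ) * (formMatrix * (uᴴ)ᵀ * formMatrix) := by rw [htu, Matrix.mul_assoc u]
        _ = _ := by rw [huu, Matrix.one_mul]
    calc uᵀ * formMatrix * u = uᵀ * formMatrix * (formMatrix * (uᴴ)ᵀ * formMatrix) := by
          rw [← h1]
      _ = uᵀ * (formMatrix * formMatrix) * (uᴴ)ᵀ * formMatrix := by simp only [Matrix.mul_assoc]
      _ = formMatrix := by rw [formMatrix_mul_self, Matrix.mul_one, hutu, Matrix.one_mul]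
  -- The determinant of `u` equals that of `b`, so it is positive, and it has absolute value one.
  have hdet : u.det = 1 := by
    obtain ⟨r, hr, h⟩ := hbpos'
    have h1 : u.det = r := by rw [hudef, Matrix.det_mul, hgdet, one_mul, h]
    have h2 := congrArg Matrix.det hu
    rw [Matrix.det_mul, Matrix.det_conjTranspose, h1, Matrix.det_one] at h2
    have h3 : r * r = 1 := by
      have : ((r * r : ℝ) : ℂ) = (1 : ℝ) := by simpa using h2
      exact_mod_cast this
    rw [h1, show r = 1 by nlinarith, Complex.ofReal_one]
  let U : SO7 := ⟨⟨u, hdet⟩, hform⟩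
  have hU : toMat U = u := rfl
  refine ⟨U, by change (toMat U)ᴴ * toMat U = 1; rw [hU, hu], ?_⟩
  rw [QuotientGroup.eq]
  apply mem_parabolic_of_grade
  have hUg : toMat (U⁻¹ * g) = c := by
    have h1 : toMat U⁻¹ = uᴴ := by
      calc toMat U⁻¹ = (uᴴ * u) * toMat U⁻¹ := by rw [hu, Matrix.one_mul]
        _ = uᴴ * (toMat U * toMat U⁻¹) := by rw [hU, Matrix.mul_assoc]
        _ = uᴴ := by rw [toMat_mul_inv, Matrix.mul_one]
    rw [toMat_mul, h1, ← huinv, Matrix.mul_assoc, toMat_inv_mul, Matrix.mul_one]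
  rw [hUg]
  have hgr : ∀ i j, grade j < grade i → i < j := by decide
  exact fun i j h => hclow i j (hgr i j h)

/-! ### The canonical metric as the metric induced from the Grassmannian of planes -/

lemma compactForm_inv {u : SO7} (hu : u ∈ compactForm) : toMat u⁻¹ = (toMat u)ᴴ := by
  calc toMat u⁻¹ = ((toMat u)ᴴ * toMat u) * toMat u⁻¹ := by rw [show _ = _ from hu, Matrix.one_mul]
    _ = (toMat u)ᴴ := by rw [Matrix.mul_assoc, toMat_mul_inv, Matrix.mul_one]

lemma compactForm_mul_conjTranspose {u : SO7} (hu : u ∈ compactForm) :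
    toMat u * (toMat u)ᴴ = 1 := by
  rw [← compactForm_inv hu, toMat_mul_inv]

/-- If the columns of `C` span the isotropic plane that corresponds to `gP`, then the canonical
metric at `gP` is the metric of the Grassmannian at the span of `C`. -/
lemma canonicalMetric_mk (g : SO7) {A B : Mat} (hA : A ∈ so7) (hB : B ∈ so7)
    {C : Matrix (Fin 7) (Fin 2) ℂ} {W M : Matrix (Fin 2) (Fin 2) ℂ} (hW : IsUnit W.det)
    (hC : C * W = toMat g * inclusion) (hM : M * (Cᴴ * C) = 1) :
    canonicalMetric (QuotientGroup.mk g) A B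
      = (M * (B * C)ᴴ * (1 - C * M * Cᴴ) * (A * C)).trace := by
  set u := transporter (QuotientGroup.mk g) with hudef
  obtain ⟨hu, hug⟩ : u ∈ compactForm ∧ (QuotientGroup.mk u : Space) = QuotientGroup.mk g :=
    Classical.epsilon_spec (exists_compactForm (QuotientGroup.mk g))
  have hp := toMat_mul_inclusion_of_mem_parabolic (QuotientGroup.eq.1 hug)
  set q₀ := inclusionᴴ * (toMat (u⁻¹ * g) * inclusion) with hq₀
  have hui := compactForm_inv hu
  have huu := compactForm_mul_conjTranspose hu
  have huu' : (toMat u)ᴴ * toMat u = 1 := hu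
  -- `C = u * inclusion * q`
  set q := q₀ * W⁻¹ with hq
  have hCq : C = toMat u * inclusion * q := by
    calc C = C * W * W⁻¹ := by rw [Matrix.mul_assoc, Matrix.mul_nonsing_inv W hW, Matrix.mul_one]
      _ = toMat u * (toMat (u⁻¹ * g) * inclusion) * W⁻¹ := by
          rw [hC, ← Matrix.mul_assoc (toMat u), ← toMat_mul, mul_inv_cancel_left]
      _ = _ := by rw [hp]; simp only [hq, Matrix.mul_assoc]
  have hCC : Cᴴ * C = qᴴ * q := by
    calc Cᴴ * C = qᴴ * (inclusionᴴ * ((toMat u)ᴴ * toMat u) * inclusion) * q := by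
          rw [hCq]; simp only [Matrix.conjTranspose_mul, Matrix.mul_assoc]
      _ = qᴴ * q := by
          rw [huu', Matrix.mul_one, inclusion_conjTranspose_mul, Matrix.mul_one]
  have hqM : q * M * qᴴ = 1 := by
    rw [hCC, ← Matrix.mul_assoc] at hM
    rw [Matrix.mul_assoc]
    exact mul_eq_one_comm.1 hM
  have hproj : toMat u * (inclusion * inclusionᴴ) * (toMat u)ᴴ = C * M * Cᴴ := by
    calc toMat u * (inclusion * inclusionᴴ) * (toMat u)ᴴ
        = toMat u * inclusion * (q * M * qᴴ) * inclusionᴴ * (toMat u)ᴴ := by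
          rw [hqM, Matrix.mul_one]; simp only [Matrix.mul_assoc]
      _ = C * M * Cᴴ := by
          rw [hCq]; simp only [Matrix.conjTranspose_mul, Matrix.mul_assoc]
  have hproj' : toMat u * (1 - inclusion * inclusionᴴ) * (toMat u)ᴴ = 1 - C * M * Cᴴ := by
    rw [Matrix.mul_sub, Matrix.sub_mul, Matrix.mul_one, huu, hproj]
  have hAd : ∀ X : Mat, adjointAction u⁻¹ X = (toMat u)ᴴ * X * toMat u := fun X => by
    rw [adjointAction, hui, inv_inv]
  rw [canonicalMetric, ← hudef, baseMetric_eq (adjointAction_mem_so7 _ hA)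
    (adjointAction_mem_so7 _ hB), hAd, hAd]
  calc (((toMat u)ᴴ * B * toMat u * inclusion)ᴴ * (1 - inclusion * inclusionᴴ)
          * ((toMat u)ᴴ * A * toMat u * inclusion)).trace
      = ((inclusionᴴ * (toMat u)ᴴ) * (Bᴴ * (toMat u * (1 - inclusion * inclusionᴴ) * (toMat u)ᴴ)
          * A * toMat u * inclusion)).trace := by
        simp only [Matrix.conjTranspose_mul, Matrix.conjTranspose_conjTranspose, Matrix.mul_assoc]
    _ = (Bᴴ * (1 - C * M * Cᴴ) * A * (toMat u * (inclusion * inclusionᴴ) * (toMat u)ᴴ)).trace := by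
        rw [hproj', Matrix.trace_mul_comm]; simp only [Matrix.mul_assoc]
    _ = ((Bᴴ * (1 - C * M * Cᴴ) * (A * C)) * (M * Cᴴ)).trace := by
        rw [hproj]; simp only [Matrix.mul_assoc]
    _ = _ := by
        rw [Matrix.trace_mul_comm]; simp only [Matrix.conjTranspose_mul, Matrix.mul_assoc]

/-- `1 - C M Cᴴ` is the orthogonal projection away from the column space of `C`, so the summands `C
* Si` and `C * Sj`, which move the frame within its plane, drop out. The unitary `u` cancels. -/
lemma grassmannian_metric_aux {u : Mat} {Y Yi Yj C : Matrix (Fin 7) (Fin 2) ℂ}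
    {M Si Sj : Matrix (Fin 2) (Fin 2) ℂ} (hu : uᴴ * u = 1) (hYi : inclusionᴴ * Yi = 0) (hYj : inclusionᴴ * Yj = 0) (hC : C = u * (inclusion + Y))
    (hM : (Cᴴ * C) * M = 1) :
    M * (u * Yj + C * Sj)ᴴ * (1 - C * M * Cᴴ) * (u * Yi + C * Si)
      = M * Yjᴴ * (1 - Y * M * Yᴴ) * Yi := by
  have hM' : M * (Cᴴ * C) = 1 := mul_eq_one_comm.1 hM
  have h1 : (1 - C * M * Cᴴ) * C = 0 := by
    rw [Matrix.sub_mul, Matrix.one_mul, Matrix.mul_assoc, Matrix.mul_assoc, hM', Matrix.mul_one,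
      sub_self]
  have h2 : Cᴴ * (1 - C * M * Cᴴ) = 0 := by
    rw [Matrix.mul_sub, Matrix.mul_one, ← Matrix.mul_assoc, ← Matrix.mul_assoc, hM, Matrix.one_mul,
      sub_self]
  have hYj' : Yjᴴ * inclusion = 0 := by
    rw [← Matrix.conjTranspose_conjTranspose inclusion, ← Matrix.conjTranspose_mul, hYj,
      Matrix.conjTranspose_zero]
  have h3 : (u * Yj)ᴴ * C = Yjᴴ * Y := by
    rw [hC, Matrix.conjTranspose_mul, Matrix.mul_assoc, ← Matrix.mul_assoc uᴴ, hu, Matrix.one_mul,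
      Matrix.mul_add, hYj', zero_add]
  have h4 : Cᴴ * (u * Yi) = Yᴴ * Yi := by
    rw [hC, Matrix.conjTranspose_mul, Matrix.mul_assoc, ← Matrix.mul_assoc uᴴ, hu, Matrix.one_mul,
      Matrix.conjTranspose_add, Matrix.add_mul, hYi, zero_add]
  have h5 : (u * Yj)ᴴ * (u * Yi) = Yjᴴ * Yi := by
    rw [Matrix.conjTranspose_mul, Matrix.mul_assoc, ← Matrix.mul_assoc uᴴ, hu, Matrix.one_mul]
  calc M * (u * Yj + C * Sj)ᴴ * (1 - C * M * Cᴴ) * (u * Yi + C * Si)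
      = M * ((u * Yj)ᴴ * ((1 - C * M * Cᴴ) * (u * Yi) + ((1 - C * M * Cᴴ) * C) * Si)
        + Sjᴴ * ((Cᴴ * (1 - C * M * Cᴴ)) * (u * Yi + C * Si))) := by
        rw [Matrix.conjTranspose_add, Matrix.conjTranspose_mul C]
        simp only [Matrix.mul_add, Matrix.add_mul, Matrix.mul_assoc]
        abel
    _ = M * ((u * Yj)ᴴ * (u * Yi) - ((u * Yj)ᴴ * C) * M * (Cᴴ * (u * Yi))) := by
        rw [h1, h2, Matrix.zero_mul, Matrix.zero_mul, Matrix.mul_zero, add_zero, add_zero,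
          Matrix.sub_mul, Matrix.mul_sub, Matrix.one_mul]
        simp only [Matrix.mul_assoc]
    _ = _ := by
        rw [h3, h4, h5]
        simp only [Matrix.mul_assoc, Matrix.sub_mul, Matrix.mul_sub, Matrix.one_mul]

/-! ### Holomorphic matrix-valued functions -/

/-- The entries of `f` are holomorphic near `z`. -/
def HolomorphicNear {m n : Type*} (f : (Fin 7 → ℂ) → Matrix m n ℂ) (z : Fin 7 → ℂ) : Prop :=
  ∀ᶠ w in 𝓝 z, ∀ i j, DifferentiableAt ℂ (fun x => f x i j) w

/-- The partial derivative of a matrix-valued holomorphic function. -/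
def matDeriv {m n : Type*} (f : (Fin 7 → ℂ) → Matrix m n ℂ) (i : Fin 7) (z : Fin 7 → ℂ) :
    Matrix m n ℂ :=
  Matrix.of fun a b => fderiv ℂ (fun w => f w a b) z (Pi.single i 1)

section HolomorphicNear

variable {m n p : Type*} {f g : (Fin 7 → ℂ) → Matrix m n ℂ} {z : Fin 7 → ℂ}

lemma HolomorphicNear.eventually (hf : HolomorphicNear f z) : ∀ᶠ w in 𝓝 z, HolomorphicNear f w :=
  eventually_eventually_nhds.2 hf

lemma HolomorphicNear.differentiableAt (hf : HolomorphicNear f z) (i : m) (j : n) :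
    DifferentiableAt ℂ (fun x => f x i j) z := hf.self_of_nhds i j

lemma HolomorphicNear.matDeriv (hf : HolomorphicNear f z) (i : Fin 7) :
    HolomorphicNear (matDeriv f i) z := by
  obtain ⟨s, hs, hso, hzs⟩ := eventually_nhds_iff.1 hf
  filter_upwards [hso.mem_nhds hzs] with w hw a b
  exact (differentiableOn_fderiv_apply (f := fun x => f x a b)
    (fun w hw => (hs w hw a b).differentiableWithinAt) hso _).differentiableAt (hso.mem_nhds hw)

lemma holomorphicNear_const (c : Matrix m n ℂ) : HolomorphicNear (fun _ => c) z :=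
  Filter.Eventually.of_forall fun _ _ _ => differentiableAt_const _

lemma HolomorphicNear.sub (hf : HolomorphicNear f z) (hg : HolomorphicNear g z) :
    HolomorphicNear (fun w => f w - g w) z := by
  filter_upwards [hf, hg] with w h1 h2 a b using (h1 a b).sub (h2 a b)

lemma HolomorphicNear.mul [Fintype n] (hf : HolomorphicNear f z)
    {g : (Fin 7 → ℂ) → Matrix n p ℂ} (hg : HolomorphicNear g z) :
    HolomorphicNear (fun w => f w * g w) z := by
  filter_upwards [hf, hg] with w h1 h2 a b
  simp only [Matrix.mul_apply]
  exact DifferentiableAt.fun_sum fun x _ => (h1 a x).mul (h2 x b)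

lemma inv_fin_two_apply (A : Matrix (Fin 2) (Fin 2) ℂ) (i j : Fin 2) :
    A⁻¹ i j = (A 0 0 * A 1 1 - A 0 1 * A 1 0)⁻¹ * (!![A 1 1, -A 0 1; -A 1 0, A 0 0] i j) := by
  rw [Matrix.inv_def, Matrix.adjugate_fin_two, Matrix.det_fin_two, Ring.inverse_eq_inv']
  rfl

lemma HolomorphicNear.inv {f : (Fin 7 → ℂ) → Matrix (Fin 2) (Fin 2) ℂ} (hf : HolomorphicNear f z)
    (hdet : (f z).det ≠ 0) : HolomorphicNear (fun w => (f w)⁻¹) z := by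
  have hc : ∀ i j, ContinuousAt (fun w => f w i j) z := fun i j => (hf.differentiableAt i j).continuousAt
  have hd : ContinuousAt (fun w => (f w).det) z := by
    simp only [Matrix.det_fin_two]
    exact ((hc 0 0).mul (hc 1 1)).sub ((hc 0 1).mul (hc 1 0))
  filter_upwards [hf, hd.eventually_ne hdet] with w h1 h2 a b
  simp only [inv_fin_two_apply]
  rw [Matrix.det_fin_two] at h2
  refine DifferentiableAt.mul (DifferentiableAt.inv
    (((h1 0 0).mul (h1 1 1)).sub ((h1 0 1).mul (h1 1 0))) h2) ?_
  fin_cases a <;> fin_cases b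
  · exact h1 1 1
  · exact (h1 0 1).neg
  · exact (h1 1 0).neg
  · exact h1 0 0

lemma matDeriv_congr (h : f =ᶠ[𝓝 z] g) (i : Fin 7) : matDeriv f i z = matDeriv g i z := by
  ext a b
  have h' : (fun w => f w a b) =ᶠ[𝓝 z] fun w => g w a b := by
    filter_upwards [h] with w hw
    rw [hw]
  simp only [matDeriv, Matrix.of_apply, h'.fderiv_eq]

lemma matDeriv_const (c : Matrix m n ℂ) (i : Fin 7) : matDeriv (fun _ => c) i z = 0 := by
  ext a b
  simp [matDeriv]

lemma matDeriv_add (hf : HolomorphicNear f z) (hg : HolomorphicNear g z) (i : Fin 7) :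
    matDeriv (fun w => f w + g w) i z = matDeriv f i z + matDeriv g i z := by
  ext a b
  simp [matDeriv, fderiv_fun_add (hf.differentiableAt a b) (hg.differentiableAt a b)]

lemma matDeriv_mul [Fintype n] (hf : HolomorphicNear f z)
    {g : (Fin 7 → ℂ) → Matrix n p ℂ} (hg : HolomorphicNear g z) (i : Fin 7) :
    matDeriv (fun w => f w * g w) i z = matDeriv f i z * g z + f z * matDeriv g i z := by
  ext a b
  simp only [matDeriv, Matrix.of_apply, Matrix.add_apply, Matrix.mul_apply]
  rw [fderiv_fun_sum fun x _ => (hf.differentiableAt a x).fun_mul (hg.differentiableAt x b)]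
  simp only [sum_apply, fderiv_fun_mul (hf.differentiableAt _ _)
    (hg.differentiableAt _ _), add_apply, smul_apply, smul_eq_mul]
  rw [← Finset.sum_add_distrib]
  exact Finset.sum_congr rfl fun x _ => by ring

lemma matDeriv_transpose (i : Fin 7) : matDeriv (fun w => (f w)ᵀ) i z = (matDeriv f i z)ᵀ := rfl

lemma HolomorphicNear.transpose (hf : HolomorphicNear f z) : HolomorphicNear (fun w => (f w)ᵀ) z := by
  filter_upwards [hf] with w h a b using h b a

lemma HolomorphicNear.hasMatJet (hf : HolomorphicNear f z) (k l : Fin 7) :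
    HasMatJet k l z f (f z) (KahlerCSpace.matDeriv f k z) 0 0 := fun a b =>
  HasJet.of_holomorphic (by filter_upwards [hf] with w hw using hw a b)

lemma HolomorphicNear.hasMatJet_conjTranspose (hf : HolomorphicNear f z) (k l : Fin 7) :
    HasMatJet k l z (fun w => (f w)ᴴ) (f z)ᴴ 0 (KahlerCSpace.matDeriv f l z)ᴴ 0 := fun a b =>
  HasJet.conj_of_holomorphic (f := fun w => f w b a) (by filter_upwards [hf] with w hw using hw b a)

end HolomorphicNear

/-- Differentiate `f⁻¹ f = 1`. Because the first derivatives of `f` vanish at a point where `f = 1`,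
no quadratic terms survive. -/
lemma HasMatJet.inv {k l : Fin 7} {z : Fin 7 → ℂ} {f : (Fin 7 → ℂ) → Matrix (Fin 2) (Fin 2) ℂ}
    {d : Matrix (Fin 2) (Fin 2) ℂ} (hf : HasMatJet k l z f 1 0 0 d) :
    HasMatJet k l z (fun w => (f w)⁻¹) 1 0 0 (-d) := by
  have hz : f z = 1 := Matrix.ext fun i j => (hf i j).value
  have hs : ∀ i j, ContDiffAt ℝ 2 (fun w => f w i j) z := fun i j => (hf i j).smooth
  have hd : ContDiffAt ℝ 2 (fun w => f w 0 0 * f w 1 1 - f w 0 1 * f w 1 0) z :=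
    ((hs 0 0).mul (hs 1 1)).sub ((hs 0 1).mul (hs 1 0))
  have hsmooth : ∀ i j, ContDiffAt ℝ 2 (fun w => (f w)⁻¹ i j) z := by
    intro i j
    simp only [inv_fin_two_apply]
    refine ContDiffAt.mul (hd.inv (by simp [hz])) ?_
    fin_cases i <;> fin_cases j
    · exact hs 1 1
    · exact (hs 0 1).neg
    · exact (hs 1 0).neg
    · exact hs 0 0
  set a : Matrix (Fin 2) (Fin 2) ℂ := (f z)⁻¹ with ha
  have ha1 : a = 1 := by rw [ha, hz, inv_one]
  set b : Matrix (Fin 2) (Fin 2) ℂ := Matrix.of fun i j => dz k (fun w => (f w)⁻¹ i j) z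
  set c : Matrix (Fin 2) (Fin 2) ℂ := Matrix.of fun i j => dzbar l (fun w => (f w)⁻¹ i j) z
  set e : Matrix (Fin 2) (Fin 2) ℂ :=
    Matrix.of fun i j => dz k (dzbar l fun w => (f w)⁻¹ i j) z
  have hg : HasMatJet k l z (fun w => (f w)⁻¹) a b c e := fun i j =>
    ⟨hsmooth i j, rfl, rfl, rfl, rfl⟩
  have hev : (fun w => (f w)⁻¹ * f w) =ᶠ[𝓝 z] fun _ => 1 := by
    have h1 : ∀ᶠ w in 𝓝 z, f w 0 0 * f w 1 1 - f w 0 1 * f w 1 0 ≠ 0 :=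
      hd.continuousAt.eventually_ne (by simp [hz])
    filter_upwards [h1] with w hw
    exact Matrix.nonsing_inv_mul _ (by rw [Matrix.det_fin_two]; exact isUnit_iff_ne_zero.2 hw)
  have h1 := hg.mul hf
  have h2 := (HasMatJet.const (k := k) (l := l) (z := z) (1 : Matrix (Fin 2) (Fin 2) ℂ)).congr hev
  simp only [Matrix.mul_one, Matrix.mul_zero, add_zero, ha1, Matrix.one_mul] at h1
  have hb : b = 0 := Matrix.ext fun i j => (h1 i j).dz_eq.symm.trans (h2 i j).dz_eq
  have hc : c = 0 := Matrix.ext fun i j => (h1 i j).dzbar_eq.symm.trans (h2 i j).dzbar_eq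
  have he : e + d = 0 := Matrix.ext fun i j => (h1 i j).mixed_eq.symm.trans (h2 i j).mixed_eq
  rwa [ha1, hb, hc, eq_neg_of_add_eq_zero_left he] at hg

/-! ### Affine coordinates of the isotropic planes -/

lemma Coordinates.holomorphicNear (φ : Coordinates) {z : Fin 7 → ℂ} (hz : z ∈ φ.domain) :
    HolomorphicNear (fun w => toMat (φ.lift w)) z := by
  filter_upwards [φ.isOpen_domain.mem_nhds hz] with w hw a b
  exact (φ.holomorphic a b).differentiableAt (φ.isOpen_domain.mem_nhds hw)

lemma Coordinates.vector_mem_so7 (φ : Coordinates) {z : Fin 7 → ℂ} (hz : z ∈ φ.domain)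
    (i : Fin 7) : φ.vector z i ∈ so7 := by
  have hg := φ.holomorphicNear hz
  have h0 : matDeriv (fun w => (toMat (φ.lift w))ᵀ * formMatrix * toMat (φ.lift w)) i z = 0 := by
    simp only [toMat_form]
    exact matDeriv_const _ _
  rw [matDeriv_mul (hg.transpose.mul (holomorphicNear_const _)) hg,
    matDeriv_mul hg.transpose (holomorphicNear_const _), matDeriv_const, Matrix.mul_zero, add_zero,
    matDeriv_transpose] at h0
  set g := toMat (φ.lift z) with hgdef
  set g' := toMat (φ.lift z)⁻¹ with hg'def
  set D := matDeriv (fun w => toMat (φ.lift w)) i z with hD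
  have hv : φ.vector z i = D * g' := rfl
  have hgg : g * g' = 1 := toMat_mul_inv _
  have hgg' : g'ᵀ * gᵀ = 1 := by rw [← Matrix.transpose_mul, hgg, Matrix.transpose_one]
  rw [mem_so7_iff, hv, Matrix.transpose_mul]
  calc g'ᵀ * Dᵀ * formMatrix + formMatrix * (D * g')
      = g'ᵀ * Dᵀ * formMatrix * (g * g') + (g'ᵀ * gᵀ) * formMatrix * (D * g') := by
        rw [hgg, hgg', Matrix.mul_one, Matrix.one_mul]
    _ = g'ᵀ * (Dᵀ * formMatrix * g + gᵀ * formMatrix * D) * g' := by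
        simp only [Matrix.mul_add, Matrix.add_mul, Matrix.mul_assoc]
    _ = 0 := by rw [h0, Matrix.mul_zero, Matrix.zero_mul]

lemma inclusion_isotropic : inclusionᵀ * formMatrix * inclusion = 0 := by
  ext a b
  rw [mul_inclusion_apply, mul_formMatrix_apply]
  fin_cases a <;> fin_cases b <;> rfl

/-- Near a given point, after a unitary change of basis, the plane with coordinates `w` is the
graph of `Y w`, with `Y` holomorphic and zero at the given point. -/
theorem Coordinates.exists_affine (φ : Coordinates) {z : Fin 7 → ℂ} (hz : z ∈ φ.domain) :
    ∃ Y : (Fin 7 → ℂ) → Matrix (Fin 7) (Fin 2) ℂ, HolomorphicNear Y z ∧ Y z = 0 ∧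
      (∀ᶠ w in 𝓝 z, inclusionᴴ * Y w = 0) ∧
      (∀ᶠ w in 𝓝 z, (inclusion + Y w)ᵀ * formMatrix * (inclusion + Y w) = 0) ∧
      ∀ᶠ w in 𝓝 z, ∀ i j, φ.metric w i j = ((1 + (Y w)ᴴ * Y w)⁻¹ * (matDeriv Y j w)ᴴ
        * (1 - Y w * (1 + (Y w)ᴴ * Y w)⁻¹ * (Y w)ᴴ) * matDeriv Y i w).trace := by
  -- Moving the given point to the base point by `u` makes the graph function vanish there.
  obtain ⟨u, hu, hux⟩ := exists_compactForm (QuotientGroup.mk (φ.lift z))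
  have hp := toMat_mul_inclusion_of_mem_parabolic (QuotientGroup.eq.1 hux)
  have hu' : (toMat u)ᴴ * toMat u = 1 := hu
  have hg := φ.holomorphicNear hz
  set G : (Fin 7 → ℂ) → Matrix (Fin 7) (Fin 2) ℂ :=
    fun w => toMat u⁻¹ * toMat (φ.lift w) * inclusion with hGdef
  have hG : HolomorphicNear G z :=
    ((holomorphicNear_const _).mul hg).mul (holomorphicNear_const _)
  have hGu : ∀ w, toMat u * G w = toMat (φ.lift w) * inclusion := fun w => by
    simp only [hGdef]
    rw [← Matrix.mul_assoc, ← Matrix.mul_assoc, toMat_mul_inv, Matrix.one_mul]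
  have hGiso : ∀ w, (G w)ᵀ * formMatrix * G w = 0 := fun w => by
    have h := toMat_form (u⁻¹ * φ.lift w)
    simp only [hGdef, ← toMat_mul]
    calc (toMat (u⁻¹ * φ.lift w) * inclusion)ᵀ * formMatrix * (toMat (u⁻¹ * φ.lift w) * inclusion)
        = inclusionᵀ * ((toMat (u⁻¹ * φ.lift w))ᵀ * formMatrix * toMat (u⁻¹ * φ.lift w))
          * inclusion := by simp only [Matrix.transpose_mul, Matrix.mul_assoc]
      _ = 0 := by rw [h, inclusion_isotropic]
  set W : (Fin 7 → ℂ) → Matrix (Fin 2) (Fin 2) ℂ := fun w => inclusionᴴ * G w with hWdef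
  have hW : HolomorphicNear W z := (holomorphicNear_const _).mul hG
  have hGz : G z = inclusion * W z := by
    simp only [hWdef, hGdef, ← toMat_mul]
    exact hp
  have hWz : (W z).det ≠ 0 := by
    have h1 : (inclusionᴴ * (toMat (u⁻¹ * φ.lift z)⁻¹ * inclusion)) * W z = 1 := by
      calc (inclusionᴴ * (toMat (u⁻¹ * φ.lift z)⁻¹ * inclusion)) * W z
          = inclusionᴴ * (toMat (u⁻¹ * φ.lift z)⁻¹ * (inclusion * W z)) := by
            simp only [Matrix.mul_assoc]
        _ = inclusionᴴ * ((toMat (u⁻¹ * φ.lift z)⁻¹ * toMat (u⁻¹ * φ.lift z)) * inclusion) := by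
            rw [← hGz, Matrix.mul_assoc]; simp only [hGdef, ← toMat_mul u⁻¹]
        _ = 1 := by rw [toMat_inv_mul, Matrix.one_mul, inclusion_conjTranspose_mul]
    exact (Matrix.isUnit_det_of_left_inverse h1).ne_zero
  have hWdet : ∀ᶠ w in 𝓝 z, IsUnit (W w).det := by
    have hc : ContinuousAt (fun w => (W w).det) z := by
      have hc : ∀ i j, ContinuousAt (fun w => W w i j) z := fun i j =>
        (hW.differentiableAt i j).continuousAt
      simp only [Matrix.det_fin_two]
      exact ((hc 0 0).mul (hc 1 1)).sub ((hc 0 1).mul (hc 1 0))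
    filter_upwards [hc.eventually_ne hWz] with w hw using isUnit_iff_ne_zero.2 hw
  -- Dividing by `W`, the last two rows of `G`, normalises those rows to the identity; what is left
  -- above them is the graph.
  set Y : (Fin 7 → ℂ) → Matrix (Fin 7) (Fin 2) ℂ := fun w => G w * (W w)⁻¹ - inclusion with hYdef
  have hY : HolomorphicNear Y z := (hG.mul (hW.inv hWz)).sub (holomorphicNear_const _)
  have hYz : Y z = 0 := by
    simp only [hYdef]
    rw [hGz, Matrix.mul_assoc, Matrix.mul_nonsing_inv _ (isUnit_iff_ne_zero.2 hWz), Matrix.mul_one,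
      sub_self]
  have hYadd : ∀ w, inclusion + Y w = G w * (W w)⁻¹ := fun w => add_sub_cancel _ _
  have hYW : ∀ᶠ w in 𝓝 z, (inclusion + Y w) * W w = G w := by
    filter_upwards [hWdet] with w hw
    rw [hYadd, Matrix.mul_assoc, Matrix.nonsing_inv_mul _ hw, Matrix.mul_one]
  have hYincl : ∀ᶠ w in 𝓝 z, inclusionᴴ * Y w = 0 := by
    filter_upwards [hWdet] with w hw
    simp only [hYdef]
    rw [Matrix.mul_sub, ← Matrix.mul_assoc, Matrix.mul_nonsing_inv _ hw,
      inclusion_conjTranspose_mul, sub_self]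
  refine ⟨Y, hY, hYz, hYincl, Filter.Eventually.of_forall fun w => ?_, ?_⟩
  · rw [hYadd]
    calc (G w * (W w)⁻¹)ᵀ * formMatrix * (G w * (W w)⁻¹)
        = ((W w)⁻¹)ᵀ * ((G w)ᵀ * formMatrix * G w) * (W w)⁻¹ := by
          simp only [Matrix.transpose_mul, Matrix.mul_assoc]
      _ = 0 := by rw [hGiso, Matrix.mul_zero, Matrix.zero_mul]
  have hNdet : ∀ᶠ w in 𝓝 z, IsUnit (1 + (Y w)ᴴ * Y w).det := by
    have hj := (HasMatJet.const (k := 0) (l := 0) (z := z) (1 : Matrix (Fin 2) (Fin 2) ℂ)).add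
      ((hY.hasMatJet_conjTranspose 0 0).mul (hY.hasMatJet 0 0))
    have hc : ContinuousAt (fun w => (1 + (Y w)ᴴ * Y w).det) z := by
      have hc : ∀ i j, ContinuousAt
          (fun w => (1 + (Y w)ᴴ * Y w : Matrix (Fin 2) (Fin 2) ℂ) i j) z := fun i j =>
        (hj i j).smooth.continuousAt
      simp only [Matrix.det_fin_two]
      exact ((hc 0 0).mul (hc 1 1)).sub ((hc 0 1).mul (hc 1 0))
    have h0 : (1 + (Y z)ᴴ * Y z).det ≠ (0 : ℂ) := by simp [hYz]
    filter_upwards [hc.eventually_ne h0] with w hw using isUnit_iff_ne_zero.2 hw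
  filter_upwards [eventually_eventually_nhds.2 hYW, eventually_eventually_nhds.2 hYincl, hWdet,
    hNdet, hY.eventually, hW.eventually, hG.eventually, φ.isOpen_domain.mem_nhds hz]
    with w hYWw hYiw hWw hNw hYw hWhw hGw hwd i j
  have hgw := φ.holomorphicNear hwd
  set M := (1 + (Y w)ᴴ * Y w)⁻¹ with hM
  set C := toMat u * (inclusion + Y w) with hC
  have hYi0 : inclusionᴴ * Y w = 0 := hYiw.self_of_nhds
  have hdYi : ∀ i, inclusionᴴ * matDeriv Y i w = 0 := fun i => by
    have h := matDeriv_congr (g := fun _ => 0) hYiw i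
    rwa [matDeriv_mul (holomorphicNear_const _) hYw, matDeriv_const, matDeriv_const,
      Matrix.zero_mul, zero_add] at h
  have hYi0' : (Y w)ᴴ * inclusion = 0 := by
    rw [← Matrix.conjTranspose_conjTranspose inclusion, ← Matrix.conjTranspose_mul, hYi0,
      Matrix.conjTranspose_zero]
  have hCC : Cᴴ * C = 1 + (Y w)ᴴ * Y w := by
    rw [hC, Matrix.conjTranspose_mul, Matrix.mul_assoc, ← Matrix.mul_assoc (toMat u)ᴴ, hu',
      Matrix.one_mul, Matrix.conjTranspose_add, Matrix.add_mul, Matrix.mul_add, Matrix.mul_add,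
      inclusion_conjTranspose_mul, hYi0, hYi0', add_zero, zero_add]
  have hCM : (Cᴴ * C) * M = 1 := by rw [hCC, hM, Matrix.mul_nonsing_inv _ hNw]
  have hCW : C * W w = toMat (φ.lift w) * inclusion := by
    rw [hC, Matrix.mul_assoc, hYWw.self_of_nhds, hGu]
  -- The product rule for `C W` splits the velocity into the motion `dY` of the plane and a motion
  -- of the frame inside the plane. The metric ignores the latter.
  have hvec : ∀ i, φ.vector w i * C
      = toMat u * matDeriv Y i w + C * (matDeriv W i w * (W w)⁻¹) := fun i => by
    have h1 : φ.vector w i * (C * W w)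
        = matDeriv (fun w => toMat (φ.lift w)) i w * inclusion := by
      have hv : φ.vector w i
          = matDeriv (fun w => toMat (φ.lift w)) i w * toMat (φ.lift w)⁻¹ := rfl
      rw [hCW, hv, Matrix.mul_assoc, ← Matrix.mul_assoc _ (toMat (φ.lift w)), toMat_inv_mul, Matrix.one_mul]
    have h2 : matDeriv (fun w => toMat (φ.lift w)) i w * inclusion
        = toMat u * (matDeriv Y i w * W w + (inclusion + Y w) * matDeriv W i w) := by
      have e1 := matDeriv_mul hgw (holomorphicNear_const inclusion) i
      rw [matDeriv_const, Matrix.mul_zero, add_zero] at e1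
      have hadd : HolomorphicNear (fun w => inclusion + Y w) w := by
        filter_upwards [hYw] with x hx a b using (differentiableAt_const _).add (hx a b)
      have e2 := matDeriv_mul hadd hWhw i
      rw [matDeriv_add (holomorphicNear_const _) hYw, matDeriv_const, zero_add,
        matDeriv_congr hYWw i] at e2
      have e3 := matDeriv_mul (holomorphicNear_const (toMat u)) hGw i
      rw [matDeriv_const, Matrix.zero_mul, zero_add, e2] at e3
      rw [← e1, ← e3]
      simp only [hGu]
    calc φ.vector w i * C = φ.vector w i * (C * W w) * (W w)⁻¹ := by
          rw [Matrix.mul_assoc, Matrix.mul_assoc, Matrix.mul_nonsing_inv _ hWw, Matrix.mul_one]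
      _ = toMat u * matDeriv Y i w * (W w * (W w)⁻¹)
            + C * (matDeriv W i w * (W w)⁻¹) := by
          rw [h1, h2]
          simp only [hC, Matrix.mul_add, Matrix.add_mul, Matrix.mul_assoc]
      _ = _ := by rw [Matrix.mul_nonsing_inv _ hWw, Matrix.mul_one]
  change canonicalMetric (QuotientGroup.mk (φ.lift w)) (φ.vector w i) (φ.vector w j) = _
  rw [canonicalMetric_mk (φ.lift w) (φ.vector_mem_so7 hwd i) (φ.vector_mem_so7 hwd j) hWw hCW
    (mul_eq_one_comm.1 hCM), hvec i, hvec j, grassmannian_metric_aux hu' (hdYi i) (hdYi j) hC hCM]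

/-! ### The curvature tensor -/

/-- At `Y = 0` both `(1 + Yᴴ Y)⁻¹` and the projection are the identity to first order. Their mixed
second derivatives `-Y_lᴴ Y_k` and `-Y_k Y_lᴴ` give the two quartic traces; the remaining term comes
from differentiating `dY` twice. -/
lemma hasJet_metric {h : (Fin 7 → ℂ) → Mat} {z : Fin 7 → ℂ} {c : ℂ}
    {Y : (Fin 7 → ℂ) → Matrix (Fin 7) (Fin 2) ℂ} (hY : HolomorphicNear Y z) (hYz : Y z = 0)
    (hh : ∀ᶠ w in 𝓝 z, ∀ i j, h w i j = ((1 + (Y w)ᴴ * Y w)⁻¹ * (matDeriv Y j w)ᴴ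
        * (1 - Y w * (1 + (Y w)ᴴ * Y w)⁻¹ * (Y w)ᴴ) * matDeriv Y i w).trace)
    (i j k l : Fin 7) :
    HasJet k l z (fun w => (c • h w) i j)
      (c * ((matDeriv Y j z)ᴴ * matDeriv Y i z).trace)
      (c * ((matDeriv Y j z)ᴴ * matDeriv (matDeriv Y i) k z).trace)
      (c * ((matDeriv (matDeriv Y j) l z)ᴴ * matDeriv Y i z).trace)
      (c * (((matDeriv (matDeriv Y j) l z)ᴴ * matDeriv (matDeriv Y i) k z).trace
        - ((matDeriv Y l z)ᴴ * matDeriv Y k z * (matDeriv Y j z)ᴴ * matDeriv Y i z).trace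
        - ((matDeriv Y j z)ᴴ * matDeriv Y k z * (matDeriv Y l z)ᴴ * matDeriv Y i z).trace)) := by
  have jY := hY.hasMatJet k l
  have jYH := hY.hasMatJet_conjTranspose k l
  rw [hYz, Matrix.conjTranspose_zero] at jYH
  rw [hYz] at jY
  have jN := (HasMatJet.const (k := k) (l := l) (z := z) (1 : Matrix (Fin 2) (Fin 2) ℂ)).add
    (jYH.mul jY)
  simp only [Matrix.zero_mul, Matrix.mul_zero, add_zero, zero_add] at jN
  have jM := jN.inv
  have jP := (HasMatJet.const (k := k) (l := l) (z := z) (1 : Mat)).sub ((jY.mul jM).mul jYH)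
  simp only [Matrix.zero_mul, Matrix.mul_zero, add_zero, zero_add, Matrix.mul_one, sub_zero,
    zero_sub] at jP
  have j1 := jM.mul ((hY.matDeriv j).hasMatJet_conjTranspose k l)
  have j2 := (j1.mul jP).mul ((hY.matDeriv i).hasMatJet k l)
  simp only [Matrix.zero_mul, Matrix.mul_zero, add_zero, zero_add, Matrix.mul_one,
    Matrix.one_mul] at j2
  have j3 := (HasJet.const (k := k) (l := l) (z := z) c).mul j2.trace
  simp only [zero_mul, zero_add, Matrix.add_mul, Matrix.neg_mul, Matrix.mul_neg, Matrix.trace_add,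
    Matrix.trace_neg] at j3
  have j4 : HasJet k l z (fun w => (c • h w) i j) _ _ _ _ := j3.congr (by
    filter_upwards [hh] with w hw
    rw [Matrix.smul_apply, smul_eq_mul, hw i j])
  convert j4 using 2
  rw [← Matrix.mul_assoc]
  ring

lemma sum_sum_sum_reverse {ι : Type*} [Fintype ι] (f : ι → ι → ι → ℂ) :
    ∑ j, ∑ k, ∑ l, f j k l = ∑ l, ∑ k, ∑ j, f j k l := by
  calc ∑ j, ∑ k, ∑ l, f j k l = ∑ j, ∑ l, ∑ k, f j k l :=
        Finset.sum_congr rfl fun j _ => Finset.sum_comm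
    _ = ∑ l, ∑ j, ∑ k, f j k l := Finset.sum_comm
    _ = _ := Finset.sum_congr rfl fun l _ => Finset.sum_comm

lemma sum_mul_sum_interleave {ι : Type*} [Fintype ι] (f g : ι → ι → ℂ) :
    ∑ i, ∑ j, ∑ k, ∑ l, f i k * g j l = (∑ i, ∑ k, f i k) * ∑ j, ∑ l, g j l := by
  simp only [Finset.sum_mul]
  refine Finset.sum_congr rfl fun i _ => ?_
  rw [Finset.sum_comm]
  refine Finset.sum_congr rfl fun k _ => ?_
  simp only [Finset.mul_sum]

/-! ### Contraction of the curvature coefficients with tangent vectors -/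

section Contraction

variable {n m : Type*} [Fintype n] [Fintype m] {ι : Type*} [Fintype ι]

lemma sum_trace_four (Y : ι → Matrix n m ℂ) (x y v w : ι → ℂ) :
    ∑ i, ∑ j, ∑ k, ∑ l, ((Y l)ᴴ * Y k * (Y j)ᴴ * Y i).trace * x i * (starRingEnd ℂ) (y j) * v k
      * (starRingEnd ℂ) (w l)
      = ((∑ l, w l • Y l)ᴴ * (∑ k, v k • Y k) * (∑ j, y j • Y j)ᴴ * (∑ i, x i • Y i)).trace := by
  simp only [Matrix.conjTranspose_sum, Matrix.conjTranspose_smul, Matrix.sum_mul, Matrix.mul_sum,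
    Matrix.smul_mul, Matrix.mul_smul, Matrix.trace_sum, Matrix.trace_smul, smul_eq_mul,
    Finset.mul_sum, ← starRingEnd_apply]
  refine Finset.sum_congr rfl fun i _ => Finset.sum_congr rfl fun j _ =>
    Finset.sum_congr rfl fun k _ => Finset.sum_congr rfl fun l _ => ?_
  ring

lemma sum_trace_four_swap (Y : ι → Matrix n m ℂ) (x y v w : ι → ℂ) :
    ∑ i, ∑ j, ∑ k, ∑ l, ((Y j)ᴴ * Y k * (Y l)ᴴ * Y i).trace * x i * (starRingEnd ℂ) (y j) * v k
      * (starRingEnd ℂ) (w l)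
      = ((∑ j, y j • Y j)ᴴ * (∑ k, v k • Y k) * (∑ l, w l • Y l)ᴴ * (∑ i, x i • Y i)).trace := by
  rw [← sum_trace_four]
  refine Finset.sum_congr rfl fun i _ => ?_
  rw [sum_sum_sum_reverse]
  refine Finset.sum_congr rfl fun j _ => Finset.sum_congr rfl fun k _ =>
    Finset.sum_congr rfl fun l _ => ?_
  ring

lemma sum_trace_conjTranspose_mul (Y : ι → Matrix n m ℂ) (x : ι → ℂ) (Z : Matrix n m ℂ) :
    ∑ q, (starRingEnd ℂ) (x q) * ((Y q)ᴴ * Z).trace = ((∑ q, x q • Y q)ᴴ * Z).trace := by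
  simp only [Matrix.conjTranspose_sum, Matrix.conjTranspose_smul, Matrix.sum_mul, Matrix.smul_mul,
    Matrix.trace_sum, Matrix.trace_smul, smul_eq_mul, ← starRingEnd_apply]

lemma sum_trace_mul (Y : ι → Matrix n m ℂ) (x : ι → ℂ) (Z : Matrix m n ℂ) :
    ∑ q, x q * (Z * Y q).trace = (Z * ∑ q, x q • Y q).trace := by
  simp only [Matrix.mul_sum, Matrix.mul_smul, Matrix.trace_sum, Matrix.trace_smul, smul_eq_mul]

lemma sum_sum_trace_mul (S : ι → ι → Matrix n m ℂ) (x v : ι → ℂ) (Z : Matrix m n ℂ) :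
    ∑ i, ∑ k, (Z * S i k).trace * x i * v k
      = (Z * ∑ i, ∑ k, (x i * v k) • S i k).trace := by
  simp only [Matrix.mul_sum, Matrix.mul_smul, Matrix.trace_sum, Matrix.trace_smul, smul_eq_mul]
  exact Finset.sum_congr rfl fun i _ => Finset.sum_congr rfl fun k _ => by ring

lemma sum_sum_trace_conjTranspose_mul (S : ι → ι → Matrix n m ℂ) (x v : ι → ℂ)
    (Z : Matrix n m ℂ) :
    ∑ j, ∑ l, ((S j l)ᴴ * Z).trace * (starRingEnd ℂ) (x j) * (starRingEnd ℂ) (v l)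
      = ((∑ j, ∑ l, (x j * v l) • S j l)ᴴ * Z).trace := by
  simp only [Matrix.conjTranspose_sum, Matrix.conjTranspose_smul, Matrix.sum_mul, Matrix.smul_mul,
    Matrix.trace_sum, Matrix.trace_smul, smul_eq_mul, ← starRingEnd_apply, map_mul]
  exact Finset.sum_congr rfl fun i _ => Finset.sum_congr rfl fun k _ => by ring

lemma sum_trace_second (S : ι → ι → Matrix n m ℂ) (x v : ι → ℂ) :
    ∑ i, ∑ j, ∑ k, ∑ l, ((S j l)ᴴ * S i k).trace * x i * (starRingEnd ℂ) (x j) * v k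
      * (starRingEnd ℂ) (v l)
      = ((∑ i, ∑ k, (x i * v k) • S i k)ᴴ * ∑ i, ∑ k, (x i * v k) • S i k).trace := by
  rw [← sum_sum_trace_conjTranspose_mul]
  have h : ∀ j l, ((S j l)ᴴ * ∑ i, ∑ k, (x i * v k) • S i k).trace
      = ∑ i, ∑ k, ((S j l)ᴴ * S i k).trace * x i * v k := fun j l => (sum_sum_trace_mul S x v _).symm
  simp only [h, Finset.sum_mul]
  rw [Finset.sum_comm]
  refine Finset.sum_congr rfl fun j _ => ?_
  rw [sum_sum_sum_reverse]
  refine Finset.sum_congr rfl fun l _ => ?_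
  rw [Finset.sum_comm]
  exact Finset.sum_congr rfl fun i _ => Finset.sum_congr rfl fun k _ => by ring

end Contraction

/-- The matrix `U` of the frame satisfies `U H Uᴴ = 1`, so `H⁻¹ = Uᴴ U`. This turns the contraction
with the inverse metric into a sum over the frame. -/
lemma inv_apply_of_isUnitaryFrame {H : Mat} {e : Fin 7 → Fin 7 → ℂ} (he : IsUnitaryFrame H e)
    (q p : Fin 7) : H⁻¹ q p = ∑ d, (starRingEnd ℂ) (e d q) * e d p := by
  set U : Mat := Matrix.of e with hU
  have h1 : U * H * Uᴴ = 1 := by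
    ext a b
    rw [Matrix.one_apply, ← he a b, Matrix.mul_apply, Finset.sum_comm]
    refine Finset.sum_congr rfl fun j _ => ?_
    rw [Matrix.mul_apply, Finset.sum_mul]
    refine Finset.sum_congr rfl fun i _ => ?_
    simp only [hU, Matrix.of_apply, Matrix.conjTranspose_apply, starRingEnd_apply]
    ring
  have h2 : H⁻¹ = Uᴴ * U := by
    apply Matrix.inv_eq_left_inv
    rw [Matrix.mul_assoc]
    exact mul_eq_one_comm.1 h1
  rw [h2, Matrix.mul_apply]
  rfl

/-- The curvature in the directions of a unitary frame, when the metric has the jet of the metric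
of the Grassmannian. -/
theorem curvatureTensor_frame {H : (Fin 7 → ℂ) → Mat} {z : Fin 7 → ℂ} {c : ℂ}
    {Y : Fin 7 → Matrix (Fin 7) (Fin 2) ℂ} {S : Fin 7 → Fin 7 → Matrix (Fin 7) (Fin 2) ℂ}
    (hH : ∀ i j k l, HasJet k l z (fun w => H w i j)
      (c * ((Y j)ᴴ * Y i).trace) (c * ((Y j)ᴴ * S i k).trace) (c * ((S j l)ᴴ * Y i).trace)
      (c * (((S j l)ᴴ * S i k).trace - ((Y l)ᴴ * Y k * (Y j)ᴴ * Y i).trace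
        - ((Y j)ᴴ * Y k * (Y l)ᴴ * Y i).trace)))
    {e : Fin 7 → Fin 7 → ℂ} (he : IsUnitaryFrame (H z) e)
    {E : Fin 7 → Matrix (Fin 7) (Fin 2) ℂ} (hE : ∀ a, E a = ∑ i, e a i • Y i)
    {T : Fin 7 → Fin 7 → Matrix (Fin 7) (Fin 2) ℂ}
    (hT : ∀ a b, T a b = ∑ i, ∑ k, (e a i * e b k) • S i k) (a b : Fin 7) :
    curvatureTensor H z (e a) (e a) (e b) (e b)
      = c * (((E b)ᴴ * E b * (E a)ᴴ * E a).trace + ((E a)ᴴ * E b * (E b)ᴴ * E a).trace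
          - ((T a b)ᴴ * T a b).trace)
        + c ^ 2 * ∑ d, ((E d)ᴴ * T a b).trace * ((T a b)ᴴ * E d).trace := by
  have hcurv : ∀ i j k l, curvature H z i j k l
      = -(c * (((S j l)ᴴ * S i k).trace - ((Y l)ᴴ * Y k * (Y j)ᴴ * Y i).trace
        - ((Y j)ᴴ * Y k * (Y l)ᴴ * Y i).trace))
        + c ^ 2 * ∑ d, ((E d)ᴴ * S i k).trace * ((S j l)ᴴ * E d).trace := by
    intro i j k l
    rw [curvature, (hH i j k l).mixed_eq]
    congr 1
    have h1 : ∀ p q, (H z)⁻¹ q p * dz k (fun w => H w i q) z * dzbar l (fun w => H w p j) z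
        = c ^ 2 * ∑ d, ((starRingEnd ℂ) (e d q) * ((Y q)ᴴ * S i k).trace)
          * (e d p * ((S j l)ᴴ * Y p).trace) := fun p q => by
      rw [inv_apply_of_isUnitaryFrame he, (hH i q k l).dz_eq, (hH p j k l).dzbar_eq,
        Finset.sum_mul, Finset.sum_mul, Finset.mul_sum]
      exact Finset.sum_congr rfl fun d _ => by ring
    simp only [h1, ← Finset.mul_sum]
    congr 1
    calc ∑ p, ∑ q, ∑ d, ((starRingEnd ℂ) (e d q) * ((Y q)ᴴ * S i k).trace)
          * (e d p * ((S j l)ᴴ * Y p).trace)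
        = ∑ d, ∑ q, ∑ p, ((starRingEnd ℂ) (e d q) * ((Y q)ᴴ * S i k).trace)
          * (e d p * ((S j l)ᴴ * Y p).trace) := sum_sum_sum_reverse _
      _ = _ := by
        refine Finset.sum_congr rfl fun d _ => ?_
        rw [← Finset.sum_mul_sum, sum_trace_conjTranspose_mul, sum_trace_mul, ← hE]
  have hsplit : ∀ i j k l, curvature H z i j k l * e a i * (starRingEnd ℂ) (e a j) * e b k
        * (starRingEnd ℂ) (e b l)
      = c * (((Y l)ᴴ * Y k * (Y j)ᴴ * Y i).trace * e a i * (starRingEnd ℂ) (e a j) * e b k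
          * (starRingEnd ℂ) (e b l))
        + c * (((Y j)ᴴ * Y k * (Y l)ᴴ * Y i).trace * e a i * (starRingEnd ℂ) (e a j) * e b k
          * (starRingEnd ℂ) (e b l))
        - c * (((S j l)ᴴ * S i k).trace * e a i * (starRingEnd ℂ) (e a j) * e b k
          * (starRingEnd ℂ) (e b l))
        + c ^ 2 * ∑ d, (((E d)ᴴ * S i k).trace * e a i * e b k)
          * (((S j l)ᴴ * E d).trace * (starRingEnd ℂ) (e a j) * (starRingEnd ℂ) (e b l)) := by
    intro i j k l
    have : ∑ d, (((E d)ᴴ * S i k).trace * e a i * e b k)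
          * (((S j l)ᴴ * E d).trace * (starRingEnd ℂ) (e a j) * (starRingEnd ℂ) (e b l))
        = (∑ d, ((E d)ᴴ * S i k).trace * ((S j l)ᴴ * E d).trace)
          * (e a i * e b k * (starRingEnd ℂ) (e a j) * (starRingEnd ℂ) (e b l)) := by
      rw [Finset.sum_mul]
      exact Finset.sum_congr rfl fun d _ => by ring
    rw [hcurv, this]
    ring
  have hlast : ∑ i, ∑ j, ∑ k, ∑ l, ∑ d, (((E d)ᴴ * S i k).trace * e a i * e b k)
          * (((S j l)ᴴ * E d).trace * (starRingEnd ℂ) (e a j) * (starRingEnd ℂ) (e b l))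
      = ∑ d, ((E d)ᴴ * T a b).trace * ((T a b)ᴴ * E d).trace := by
    have h : ∀ d, ((E d)ᴴ * T a b).trace * ((T a b)ᴴ * E d).trace
        = ∑ i, ∑ j, ∑ k, ∑ l, (((E d)ᴴ * S i k).trace * e a i * e b k)
          * (((S j l)ᴴ * E d).trace * (starRingEnd ℂ) (e a j) * (starRingEnd ℂ) (e b l)) :=
      fun d => by
        rw [sum_mul_sum_interleave (fun i k => ((E d)ᴴ * S i k).trace * e a i * e b k)
          fun j l => ((S j l)ᴴ * E d).trace * (starRingEnd ℂ) (e a j) * (starRingEnd ℂ) (e b l),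
          sum_sum_trace_mul, sum_sum_trace_conjTranspose_mul, hT]
    simp only [h]
    symm
    rw [Finset.sum_comm]
    refine Finset.sum_congr rfl fun i _ => ?_
    rw [Finset.sum_comm]
    refine Finset.sum_congr rfl fun j _ => ?_
    rw [Finset.sum_comm]
    exact Finset.sum_congr rfl fun k _ => Finset.sum_comm
  simp only [curvatureTensor, hsplit, Finset.sum_add_distrib, Finset.sum_sub_distrib,
    ← Finset.mul_sum]
  rw [hlast, sum_trace_four, sum_trace_four_swap, sum_trace_second, ← hT, ← hE, ← hE]
  ring

/-! ### The curvature form on Hermitian matrices -/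

/-- The position of the coordinate `(m, i)` of `ℂ² ⊗ ℂ³` in `ℂ⁷ = ℂ ⊕ ℂ² ⊗ ℂ³`. -/
def slot (m : Fin 2) (i : Fin 3) : Fin 7 := ![![1, 2, 3], ![4, 5, 6]] m i

/-- The contraction of a form on `ℂ ⊕ ℂ² ⊗ ℂ³` to a form on `ℂ²`. -/
def gram (A : Mat) (m n : Fin 2) : ℂ :=
  (if m = n then A 0 0 / 2 else 0) + ∑ i, A (slot n i) (slot m i)

/-- The curvature of `M`, as a bilinear form in the forms `X ⊗ X̄` and `Y ⊗ Ȳ` on the tangent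
space `ℂ ⊕ ℂ² ⊗ ℂ³`. The first two terms are the curvature of the Grassmannian, the last one comes
from the second fundamental form. -/
def curvForm (A B : Mat) : ℂ := ∑ m, ∑ n,
  (gram A m n * gram B n m
    + ((if m = n then A 0 0 * B 0 0 / 4 + (∑ j, A (slot m j) 0 * B 0 (slot n j)) / 2
        + (∑ i, A 0 (slot m i) * B (slot n i) 0) / 2 else 0)
      + ∑ i, ∑ j, A (slot m j) (slot m i) * B (slot n i) (slot n j))
    - (∑ i, ∑ j, (A (slot m i) (slot m j) * B (slot n i.rev) (slot n j.rev)
      + A (slot m i) (slot n j) * B (slot n i.rev) (slot m j.rev)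
      + A (slot n i) (slot m j) * B (slot m i.rev) (slot n j.rev)
      + A (slot n i) (slot n j) * B (slot m i.rev) (slot m j.rev))) / 4)

lemma rev_fin_three : Fin.rev (0 : Fin 3) = 2 ∧ Fin.rev (1 : Fin 3) = 1 ∧ Fin.rev (2 : Fin 3) = 0 :=
  ⟨rfl, rfl, rfl⟩

lemma slot_values : slot 0 0 = 1 ∧ slot 0 1 = 2 ∧ slot 0 2 = 3 ∧ slot 1 0 = 4 ∧ slot 1 1 = 5 ∧
    slot 1 2 = 6 := ⟨rfl, rfl, rfl, rfl, rfl, rfl⟩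

/-- `curvForm` as a bilinear map. -/
def curvBilin : Mat →ₗ[ℂ] Mat →ₗ[ℂ] ℂ := LinearMap.mk₂ ℂ curvForm
  (fun A A' B => by
    simp only [curvForm, gram, Fin.sum_univ_two, Fin.sum_univ_three, Matrix.add_apply, if_true,
      zero_ne_one, one_ne_zero, if_false]
    ring)
  (fun c A B => by
    simp only [curvForm, gram, Fin.sum_univ_two, Fin.sum_univ_three, Matrix.smul_apply,
      smul_eq_mul, if_true, zero_ne_one, one_ne_zero, if_false]
    ring)
  (fun A B B' => by
    simp only [curvForm, gram, Fin.sum_univ_two, Fin.sum_univ_three, Matrix.add_apply, if_true,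
      zero_ne_one, one_ne_zero, if_false]
    ring)
  (fun c A B => by
    simp only [curvForm, gram, Fin.sum_univ_two, Fin.sum_univ_three, Matrix.smul_apply,
      smul_eq_mul, if_true, zero_ne_one, one_ne_zero, if_false]
    ring)

lemma curvBilin_apply (A B : Mat) : curvBilin A B = curvForm A B := rfl

/-- The Einstein condition: the Ricci tensor is four times the metric. -/
lemma curvForm_one_right (A : Mat) : curvForm A 1 = 4 * A.trace := by
  simp only [curvForm, gram, Fin.sum_univ_two, Fin.sum_univ_three, slot_values, if_true,
    zero_ne_one, one_ne_zero, if_false, Matrix.trace, Matrix.diag_apply, Fin.sum_univ_seven]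
  simp [slot_values]
  ring

lemma curvForm_one_left (A : Mat) : curvForm 1 A = 4 * A.trace := by
  simp only [curvForm, gram, Fin.sum_univ_two, Fin.sum_univ_three, slot_values, if_true,
    zero_ne_one, one_ne_zero, if_false, Matrix.trace, Matrix.diag_apply, Fin.sum_univ_seven]
  simp [slot_values]
  ring

set_option maxHeartbeats 1600000 in
/-- The curvature form is bounded on Hermitian matrices by the Einstein constant. -/
theorem curvForm_self_le {A : Mat} (hA : Aᴴ = A) : (curvForm A A).re ≤ 4 * ((A * A).trace).re := by
  have h : ∀ x y, A x y = (starRingEnd ℂ) (A y x) := fun x y => (congrFun₂ hA x y).symm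
  have hd : ∀ x, (A x x).im = 0 := fun x => Complex.conj_eq_iff_im.1 (h x x).symm
  have hre : ∀ x y, (A x y).re = (A y x).re := fun x y => by rw [h x y, Complex.conj_re]
  have him : ∀ x y, (A x y).im = -(A y x).im := fun x y => by rw [h x y, Complex.conj_im]
  -- This sum of squares equals `4 tr A² - curvForm A A`. The symmetries of `ℂ ⊕ ℂ² ⊗ ℂ³` split the
  -- form into small blocks: the diagonal entries and those within one copy of `ℂ³` enter through
  -- sums and differences of the two copies, and the entries between the two copies are grouped by
  -- the weights of `ℂ³`. The first three squares vanish at `A = 1`, where the bound is sharp.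
  have S : 0 ≤ 3 * ((A 0 0).re - ((A 1 1 + A 4 4) + (A 2 2 + A 5 5) + (A 3 3 + A 6 6)).re / 6) ^ 2
      + 7 / 24 * ((A 1 1 + A 4 4) + (A 3 3 + A 6 6) - 2 * (A 2 2 + A 5 5)).re ^ 2
      + 1 / 8 * ((A 1 1 + A 4 4) - (A 3 3 + A 6 6)).re ^ 2
      + 3 / 2 * ‖(A 1 2 + A 4 5) + (A 2 3 + A 5 6)‖ ^ 2
      + 1 / 2 * ‖A 1 2 + A 4 5‖ ^ 2 + 1 / 2 * ‖A 2 3 + A 5 6‖ ^ 2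
      + 7 / 2 * ‖A 1 3 + A 4 6‖ ^ 2
      + 1 / 4 * (A 1 1 - A 4 4).re ^ 2 + 1 / 4 * (A 3 3 - A 6 6).re ^ 2
      + 3 / 4 * (A 2 2 - A 5 5).re ^ 2
      + 1 / 2 * ((A 1 1 - A 4 4) - (A 2 2 - A 5 5)).re ^ 2
      + 1 / 2 * ((A 2 2 - A 5 5) - (A 3 3 - A 6 6)).re ^ 2
      + 1 / 2 * ((A 1 1 - A 4 4) - (A 3 3 - A 6 6)).re ^ 2
      + 1 / 4 * ((A 1 1 - A 4 4) + (A 3 3 - A 6 6)).re ^ 2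
      + 1 / 2 * ‖(A 1 2 - A 4 5) + (A 2 3 - A 5 6)‖ ^ 2
      + 7 / 2 * ‖A 1 2 - A 4 5‖ ^ 2 + 7 / 2 * ‖A 2 3 - A 5 6‖ ^ 2
      + 9 / 2 * ‖A 1 3 - A 4 6‖ ^ 2
      + ‖A 1 4‖ ^ 2 + 3 * ‖A 2 5‖ ^ 2 + ‖A 3 6‖ ^ 2
      + 2 * ‖A 1 4 - A 2 5‖ ^ 2 + 2 * ‖A 2 5 - A 3 6‖ ^ 2
      + 2 * ‖A 1 4 - A 3 6‖ ^ 2 + ‖A 1 4 + A 3 6‖ ^ 2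
      + ‖A 1 5 + A 2 6‖ ^ 2 + 7 * ‖A 1 5‖ ^ 2 + 7 * ‖A 2 6‖ ^ 2
      + ‖A 2 4 + A 3 5‖ ^ 2 + 7 * ‖A 2 4‖ ^ 2 + 7 * ‖A 3 5‖ ^ 2
      + 9 * ‖A 1 6‖ ^ 2 + 9 * ‖A 3 4‖ ^ 2
      + 7 * (‖A 0 1‖ ^ 2 + ‖A 0 2‖ ^ 2 + ‖A 0 3‖ ^ 2
        + ‖A 0 4‖ ^ 2 + ‖A 0 5‖ ^ 2 + ‖A 0 6‖ ^ 2) := by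
    positivity
  simp only [Complex.sq_norm, Complex.normSq_apply, Complex.add_re, Complex.sub_re, Complex.add_im, Complex.sub_im,
    Complex.mul_re, Complex.re_ofNat, Complex.im_ofNat, zero_mul, sub_zero] at S
  have q2 : ∀ w : ℂ, (w / 2).re = w.re / 2 := fun w => by simp
  have q2' : ∀ w : ℂ, (w / 2).im = w.im / 2 := fun w => by simp
  have q4 : ∀ w : ℂ, (w / 4).re = w.re / 4 := fun w => by simp
  simp only [curvForm, gram, Fin.sum_univ_two, Fin.sum_univ_three, rev_fin_three, slot_values,
    if_true, zero_ne_one, one_ne_zero, if_false, Matrix.trace, Matrix.diag_apply, Matrix.mul_apply,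
    Fin.sum_univ_seven, Complex.add_re, Complex.sub_re, Complex.mul_re, Complex.add_im,
    q2, q2', q4, zero_add, hd, hre 1 0, hre 2 0, hre 3 0, hre 4 0, hre 5 0, hre 6 0,
    hre 2 1, hre 3 1, hre 4 1, hre 5 1, hre 6 1, hre 3 2, hre 4 2, hre 5 2, hre 6 2, hre 4 3,
    hre 5 3, hre 6 3, hre 5 4, hre 6 4, hre 6 5, him 1 0, him 2 0, him 3 0, him 4 0, him 5 0,
    him 6 0, him 2 1, him 3 1, him 4 1, him 5 1, him 6 1, him 3 2, him 4 2, him 5 2, him 6 2,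
    him 4 3, him 5 3, him 6 3, him 5 4, him 6 4, him 6 5]
  linarith

/-- Nonnegativity of the quadratic bisectional curvature for the frame of an orthogonal
decomposition of the identity into projections. -/
theorem sum_curvForm_nonneg {P : Fin 7 → Mat} (hH : ∀ a, (P a)ᴴ = P a)
    (hmul : ∀ a b, P a * P b = if a = b then P a else 0) (hsum : ∑ a, P a = 1) (x : Fin 7 → ℝ) :
    0 ≤ ∑ a, ∑ b, (curvForm (P a) (P b)).re * (x a - x b) ^ 2 := by
  set A : Mat := ∑ a, (x a : ℂ) • P a with hA
  have hAH : Aᴴ = A := by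
    rw [hA, Matrix.conjTranspose_sum]
    exact Finset.sum_congr rfl fun a _ => by
      rw [Matrix.conjTranspose_smul, hH, RCLike.star_def, Complex.conj_ofReal]
  have hAA : A * A = ∑ a, ((x a : ℂ) ^ 2) • P a := by
    rw [hA, Matrix.sum_mul]
    refine Finset.sum_congr rfl fun a _ => ?_
    rw [Matrix.mul_sum, Finset.sum_eq_single a]
    · rw [Matrix.smul_mul, Matrix.mul_smul, hmul, if_pos rfl, smul_smul, sq]
    · intro b _ hb
      rw [Matrix.smul_mul, Matrix.mul_smul, hmul, if_neg hb.symm, smul_zero, smul_zero]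
    · simp
  have h1 : ∑ a, ∑ b, (x a : ℂ) ^ 2 * curvForm (P a) (P b) = 4 * (A * A).trace := by
    rw [← curvForm_one_right, ← curvBilin_apply, hAA, ← hsum]
    simp only [map_sum, map_smul, LinearMap.sum_apply, LinearMap.smul_apply, smul_eq_mul,
      curvBilin_apply]
    rw [Finset.sum_comm]
  have h2 : ∑ a, ∑ b, (x b : ℂ) ^ 2 * curvForm (P a) (P b) = 4 * (A * A).trace := by
    rw [← curvForm_one_left, ← curvBilin_apply, hAA, ← hsum]
    simp only [map_sum, map_smul, LinearMap.sum_apply, smul_eq_mul, curvBilin_apply]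
    rw [Finset.sum_comm]
    simp only [Finset.mul_sum]
  have h3 : ∑ a, ∑ b, ((x a : ℂ) * x b) * curvForm (P a) (P b) = curvForm A A := by
    rw [← curvBilin_apply, hA]
    simp only [map_sum, map_smul, LinearMap.sum_apply, LinearMap.smul_apply, smul_eq_mul,
      curvBilin_apply]
    rw [Finset.sum_comm]
    refine Finset.sum_congr rfl fun a _ => ?_
    simp only [Finset.mul_sum]
    exact Finset.sum_congr rfl fun b _ => by ring
  -- Expanding `(x a - x b) ^ 2`, the two square terms are `curvForm (A * A) 1` and `curvForm 1 (A *
  -- A)`, and the mixed term is `-2 * curvForm A A`.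
  have key : ((∑ a, ∑ b, (curvForm (P a) (P b)).re * (x a - x b) ^ 2 : ℝ))
      = (8 * (A * A).trace - 2 * curvForm A A).re := by
    have : (8 * (A * A).trace - 2 * curvForm A A : ℂ)
        = ∑ a, ∑ b, curvForm (P a) (P b) * (((x a - x b) ^ 2 : ℝ) : ℂ) := by
      rw [← h3, show (8 * (A * A).trace : ℂ) = 4 * (A * A).trace + 4 * (A * A).trace by ring]
      nth_rewrite 1 [← h1]
      rw [← h2]
      simp only [Finset.mul_sum, ← Finset.sum_add_distrib, ← Finset.sum_sub_distrib]
      exact Finset.sum_congr rfl fun a _ => Finset.sum_congr rfl fun b _ => by push_cast; ring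
    rw [this]
    simp only [Complex.re_sum, Complex.re_mul_ofReal]
  have hle := curvForm_self_le hAH
  rw [key]
  simp only [Complex.sub_re, Complex.mul_re, Complex.re_ofNat, Complex.im_ofNat, zero_mul, sub_zero]
  linarith

/-! ### Tangent vectors as matrices -/

/-- The `7 × 2` matrices that are tangent at `0` to the isotropic planes in affine coordinates. -/
structure IsTangent (X : Matrix (Fin 7) (Fin 2) ℂ) : Prop where
  row_five : ∀ m, X 5 m = 0
  row_six : ∀ m, X 6 m = 0
  one_zero : X 1 0 = 0
  zero_one : X 0 1 = 0
  one_one : X 1 1 = -X 0 0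

/-- Orthonormal coordinates of the component of `X` in the tangent space. -/
def coords (X : Matrix (Fin 7) (Fin 2) ℂ) : Fin 7 → ℂ :=
  ![(Real.sqrt 2 : ℂ) * (X 0 0 - X 1 1) / 2, X 2 0, X 3 0, X 4 0, X 2 1, X 3 1, X 4 1]

lemma sqrt_two_mul_self : (Real.sqrt 2 : ℂ) * (Real.sqrt 2 : ℂ) = 2 := by
  exact_mod_cast Real.mul_self_sqrt (by norm_num : (0 : ℝ) ≤ 2)

/-- A tangent `X` carries the entry `X 0 0` twice, up to sign, which is why its coordinate is scaled
by `√2`. Pairing with `X` sees only the tangential part of `T`. -/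
lemma IsTangent.trace_conjTranspose_mul {X T : Matrix (Fin 7) (Fin 2) ℂ} (hX : IsTangent X) :
    (Xᴴ * T).trace = ∑ t, (starRingEnd ℂ) (coords X t) * coords T t := by
  simp only [Matrix.trace, Matrix.diag_apply, Matrix.mul_apply, Fin.sum_univ_two,
    Fin.sum_univ_seven, Matrix.conjTranspose_apply, hX.row_five, hX.row_six, hX.one_zero,
    hX.zero_one, hX.one_one, coords, RCLike.star_def]
  simp [Complex.conj_ofNat]
  linear_combination (-(starRingEnd ℂ (X 0 0)) * (T 0 0 - T 1 1) / 2) * sqrt_two_mul_self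

/-- Pythagoras: the last three terms are the squared norm of the component normal to the isotropic
planes. -/
lemma trace_conjTranspose_mul_self {T : Matrix (Fin 7) (Fin 2) ℂ} (h5 : ∀ m, T 5 m = 0)
    (h6 : ∀ m, T 6 m = 0) :
    (Tᴴ * T).trace = ∑ t, (starRingEnd ℂ) (coords T t) * coords T t
      + (starRingEnd ℂ) (T 1 0) * T 1 0 + (starRingEnd ℂ) (T 0 1) * T 0 1
      + (starRingEnd ℂ) (T 0 0 + T 1 1) * (T 0 0 + T 1 1) / 2 := by
  simp only [Matrix.trace, Matrix.diag_apply, Matrix.mul_apply, Fin.sum_univ_two,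
    Fin.sum_univ_seven, Matrix.conjTranspose_apply, h5, h6, coords, RCLike.star_def]
  simp [Complex.conj_ofNat]
  linear_combination (-(starRingEnd ℂ (T 0 0) - starRingEnd ℂ (T 1 1)) * (T 0 0 - T 1 1) / 4)
    * sqrt_two_mul_self

/-- The upper `2 × 2` block of a tangent matrix is a multiple of `diag(1, -1)`, so two such blocks
contribute a scalar matrix; the middle rows contribute the contraction over `ℂ³`. -/
lemma IsTangent.conjTranspose_mul_apply {X W : Matrix (Fin 7) (Fin 2) ℂ} (hX : IsTangent X)
    (hW : IsTangent W) (m n : Fin 2) :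
    (Xᴴ * W) m n = (if m = n then (starRingEnd ℂ) (coords X 0) * coords W 0 / 2 else 0)
      + ∑ i, (starRingEnd ℂ) (coords X (slot m i)) * coords W (slot n i) := by
  have h : (starRingEnd ℂ) (coords X 0) * coords W 0 / 2 = (starRingEnd ℂ) (X 0 0) * W 0 0 := by
    simp [coords, hX.one_one, hW.one_one, Complex.conj_ofNat]
    linear_combination ((starRingEnd ℂ (X 0 0)) * (W 0 0) / 2) * sqrt_two_mul_self
  rw [h]
  fin_cases m <;> fin_cases n <;>
    simp [Matrix.mul_apply, Fin.sum_univ_seven, Fin.sum_univ_three, slot, hX.row_five, hX.row_six,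
      hX.one_zero, hX.zero_one, hX.one_one, hW.one_zero,
      hW.zero_one, hW.one_one, coords] <;> ring

/-- The rank one form defined by `X`. -/
def rankOne (X : Matrix (Fin 7) (Fin 2) ℂ) : Mat :=
  Matrix.vecMulVec (coords X) (star (coords X))

lemma rankOne_apply (X : Matrix (Fin 7) (Fin 2) ℂ) (s t : Fin 7) :
    rankOne X s t = coords X s * (starRingEnd ℂ) (coords X t) := rfl

lemma gram_rankOne {X : Matrix (Fin 7) (Fin 2) ℂ} (hX : IsTangent X) (m n : Fin 2) :
    gram (rankOne X) m n = (Xᴴ * X) m n := by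
  rw [hX.conjTranspose_mul_apply hX, gram]
  simp only [rankOne_apply, mul_comm]

/-- The pairing of the columns of `X` and `W` in the last term of the equation of the isotropic
planes. -/
def pairing (X W : Matrix (Fin 7) (Fin 2) ℂ) (m n : Fin 2) : ℂ :=
  X 2 m * W 4 n + X 3 m * W 3 n + X 4 m * W 2 n

/-- The Gauss equation at a point of `M`. -/
lemma curvForm_rankOne {X W T : Matrix (Fin 7) (Fin 2) ℂ} (hX : IsTangent X) (hW : IsTangent W)
    (h10 : T 1 0 = -pairing X W 0 0) (h01 : T 0 1 = -pairing X W 1 1)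
    (hT : T 0 0 + T 1 1 = -(pairing X W 0 1 + pairing X W 1 0)) :
    curvForm (rankOne X) (rankOne W) = (Wᴴ * W * Xᴴ * X).trace + (Xᴴ * W * Wᴴ * X).trace
      - ((starRingEnd ℂ) (T 1 0) * T 1 0 + (starRingEnd ℂ) (T 0 1) * T 0 1
      + (starRingEnd ℂ) (T 0 0 + T 1 1) * (T 0 0 + T 1 1) / 2) := by
  have e1 : (Wᴴ * W * Xᴴ * X).trace = ∑ m, ∑ n, gram (rankOne X) m n * gram (rankOne W) n m := by
    rw [Matrix.mul_assoc, Matrix.trace_mul_comm, Matrix.trace]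
    simp only [Matrix.diag_apply, Matrix.mul_apply (M := Xᴴ * X), gram_rankOne hX, gram_rankOne hW]
  have e2 : (Xᴴ * W * Wᴴ * X).trace
      = ∑ m, ∑ n, (Xᴴ * W) m n * (starRingEnd ℂ) ((Xᴴ * W) m n) := by
    have h : Wᴴ * X = (Xᴴ * W)ᴴ := by
      rw [Matrix.conjTranspose_mul, Matrix.conjTranspose_conjTranspose]
    rw [Matrix.mul_assoc, h, Matrix.trace]
    simp only [Matrix.diag_apply, Matrix.mul_apply (M := Xᴴ * W),
      Matrix.conjTranspose_apply (M := Xᴴ * W), RCLike.star_def]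
  rw [e1, e2, hT, h10, h01]
  simp only [curvForm, hX.conjTranspose_mul_apply hW, Finset.sum_add_distrib,
    Finset.sum_sub_distrib]
  have hp : ∀ m n, pairing X W m n = ∑ i, coords X (slot m i) * coords W (slot n i.rev) := by
    intro m n
    fin_cases m <;> fin_cases n <;> simp [pairing, coords, slot, Fin.sum_univ_three, rev_fin_three]
  simp only [hp, rankOne_apply, Fin.sum_univ_two, Fin.sum_univ_three, rev_fin_three, if_true,
    zero_ne_one, one_ne_zero, if_false, map_add, map_mul, map_neg, map_div₀, Complex.conj_conj,
    Complex.conj_ofNat, map_zero]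
  ring

/-! ### The equations of the isotropic planes, differentiated -/

lemma rows_eq_zero {X : Matrix (Fin 7) (Fin 2) ℂ} (h : inclusionᴴ * X = 0) (m : Fin 2) :
    X 5 m = 0 ∧ X 6 m = 0 := by
  have h0 := congrFun₂ h 0 m
  have h1 := congrFun₂ h 1 m
  rw [inclusion_conjTranspose_mul_apply] at h0 h1
  exact ⟨h0, h1⟩

lemma matDeriv_inclusion_mul {Y : (Fin 7 → ℂ) → Matrix (Fin 7) (Fin 2) ℂ} {z : Fin 7 → ℂ}
    (hY : HolomorphicNear Y z) (h : ∀ᶠ w in 𝓝 z, inclusionᴴ * Y w = 0) (i : Fin 7) :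
    inclusionᴴ * matDeriv Y i z = 0 := by
  have h1 := matDeriv_congr (g := fun _ => 0) h i
  rwa [matDeriv_mul (holomorphicNear_const _) hY, matDeriv_const, matDeriv_const,
    Matrix.zero_mul, zero_add] at h1

lemma transpose_mul_formMatrix_mul_apply (A B : Matrix (Fin 7) (Fin 2) ℂ) (m n : Fin 2) :
    (Aᵀ * formMatrix * B) m n = ∑ r, A r.rev m * B r n := by
  rw [Matrix.mul_apply]
  simp only [mul_formMatrix_apply, Matrix.transpose_apply]

lemma transpose_mul_formMatrix_mul_inclusion (X : Matrix (Fin 7) (Fin 2) ℂ) (m n : Fin 2) :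
    (Xᵀ * formMatrix * inclusion) m n = X (![1, 0] n) m := by
  rw [mul_inclusion_apply, mul_formMatrix_apply, Matrix.transpose_apply]
  fin_cases n <;> rfl

lemma inclusion_transpose_mul_formMatrix_mul (X : Matrix (Fin 7) (Fin 2) ℂ) (m n : Fin 2) :
    (inclusionᵀ * formMatrix * X) m n = X (![1, 0] m) n := by
  have h : inclusionᵀ * formMatrix * X = (Xᵀ * formMatrix * inclusion)ᵀ := by
    simp only [Matrix.transpose_mul, Matrix.transpose_transpose, formMatrix_transpose,
      Matrix.mul_assoc]
  rw [h, Matrix.transpose_apply, transpose_mul_formMatrix_mul_inclusion]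

lemma pairing_eq {X W : Matrix (Fin 7) (Fin 2) ℂ} (hX : inclusionᴴ * X = 0)
    (hW : inclusionᴴ * W = 0) (m n : Fin 2) :
    (Xᵀ * formMatrix * W) m n = pairing X W m n := by
  obtain ⟨x5, x6⟩ := rows_eq_zero hX m
  obtain ⟨w5, w6⟩ := rows_eq_zero hW n
  have r : Fin.rev (0 : Fin 7) = 6 ∧ Fin.rev (1 : Fin 7) = 5 ∧ Fin.rev (2 : Fin 7) = 4 ∧
    Fin.rev (3 : Fin 7) = 3 ∧ Fin.rev (4 : Fin 7) = 2 ∧ Fin.rev (5 : Fin 7) = 1 ∧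
    Fin.rev (6 : Fin 7) = 0 := by decide
  rw [transpose_mul_formMatrix_mul_apply, Fin.sum_univ_seven]
  simp only [r, x5, x6, w5, w6, pairing]
  ring

lemma pairing_comm (X W : Matrix (Fin 7) (Fin 2) ℂ) (m n : Fin 2) :
    pairing X W m n = pairing W X n m := by
  simp only [pairing]; ring

lemma pairing_sum_left {ι : Type*} (s : Finset ι) (x : ι → ℂ) (X : ι → Matrix (Fin 7) (Fin 2) ℂ)
    (W : Matrix (Fin 7) (Fin 2) ℂ) (m n : Fin 2) :
    pairing (∑ i ∈ s, x i • X i) W m n = ∑ i ∈ s, x i * pairing (X i) W m n := by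
  simp only [pairing, Matrix.sum_apply, Matrix.smul_apply, smul_eq_mul, Finset.sum_mul,
    ← Finset.sum_add_distrib]
  exact Finset.sum_congr rfl fun i _ => by ring

lemma pairing_sum_sum {ι : Type*} [Fintype ι] (x y : ι → ℂ)
    (X : ι → Matrix (Fin 7) (Fin 2) ℂ) (m n : Fin 2) :
    pairing (∑ i, x i • X i) (∑ k, y k • X k) m n
      = ∑ i, ∑ k, x i * y k * pairing (X i) (X k) m n := by
  rw [pairing_sum_left]
  refine Finset.sum_congr rfl fun i _ => ?_
  rw [pairing_comm, pairing_sum_left, Finset.mul_sum]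
  exact Finset.sum_congr rfl fun k _ => by rw [pairing_comm (X k)]; ring

/-! ### First and second derivatives of the isotropy equation -/

section Isotropic

variable {Y : (Fin 7 → ℂ) → Matrix (Fin 7) (Fin 2) ℂ} {z : Fin 7 → ℂ}

lemma holomorphicNear_inclusion_add (hY : HolomorphicNear Y z) :
    HolomorphicNear (fun w => inclusion + Y w) z := by
  filter_upwards [hY] with x hx a b using (differentiableAt_const _).add (hx a b)

lemma matDeriv_inclusion_add (hY : HolomorphicNear Y z) (i : Fin 7) :
    matDeriv (fun w => inclusion + Y w) i z = matDeriv Y i z := by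
  rw [matDeriv_add (holomorphicNear_const _) hY, matDeriv_const, zero_add]

lemma isotropic_matDeriv (hY : HolomorphicNear Y z)
    (hiso : ∀ᶠ w in 𝓝 z, (inclusion + Y w)ᵀ * formMatrix * (inclusion + Y w) = 0) (i : Fin 7) :
    (matDeriv Y i z)ᵀ * formMatrix * (inclusion + Y z)
      + (inclusion + Y z)ᵀ * formMatrix * matDeriv Y i z = 0 := by
  have hC := holomorphicNear_inclusion_add hY
  have h := matDeriv_congr (g := fun _ => 0) hiso i
  rwa [matDeriv_mul (hC.transpose.mul (holomorphicNear_const _)) hC,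
    matDeriv_mul hC.transpose (holomorphicNear_const _), matDeriv_const, matDeriv_const,
    Matrix.mul_zero, add_zero, matDeriv_transpose, matDeriv_inclusion_add hY] at h

/-- At `Y = 0` the differentiated isotropy equation is linear: it says that the upper `2 × 2` block,
with its rows exchanged, is skew-symmetric. -/
lemma isTangent_matDeriv (hY : HolomorphicNear Y z) (hYz : Y z = 0)
    (hinc : ∀ᶠ w in 𝓝 z, inclusionᴴ * Y w = 0)
    (hiso : ∀ᶠ w in 𝓝 z, (inclusion + Y w)ᵀ * formMatrix * (inclusion + Y w) = 0) (i : Fin 7) :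
    IsTangent (matDeriv Y i z) := by
  have hr := rows_eq_zero (matDeriv_inclusion_mul hY hinc i)
  have h := isotropic_matDeriv hY hiso i
  rw [hYz, add_zero] at h
  have hmn : ∀ m n, matDeriv Y i z (![1, 0] n) m + matDeriv Y i z (![1, 0] m) n = 0 := fun m n => by
    have h' := congrFun₂ h m n
    rwa [Matrix.add_apply, Matrix.zero_apply, transpose_mul_formMatrix_mul_inclusion,
      inclusion_transpose_mul_formMatrix_mul] at h'
  have h00 : matDeriv Y i z 1 0 + matDeriv Y i z 1 0 = 0 := hmn 0 0
  have h11 : matDeriv Y i z 0 1 + matDeriv Y i z 0 1 = 0 := hmn 1 1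
  have h01 : matDeriv Y i z 0 0 + matDeriv Y i z 1 1 = 0 := hmn 0 1
  exact ⟨fun m => (hr m).1, fun m => (hr m).2, add_self_eq_zero.1 h00, add_self_eq_zero.1 h11,
    eq_neg_of_add_eq_zero_right h01⟩

/-- The second fundamental form. The left side is the linear expression that vanishes for tangent
matrices; the second derivative misses it by a quadratic term in the first derivatives, so its
normal part is known while its tangential part depends on the coordinates. -/
lemma matDeriv_matDeriv_isotropic (hY : HolomorphicNear Y z) (hYz : Y z = 0)
    (hinc : ∀ᶠ w in 𝓝 z, inclusionᴴ * Y w = 0)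
    (hiso : ∀ᶠ w in 𝓝 z, (inclusion + Y w)ᵀ * formMatrix * (inclusion + Y w) = 0)
    (i k : Fin 7) (m n : Fin 2) :
    matDeriv (matDeriv Y i) k z (![1, 0] n) m + matDeriv (matDeriv Y i) k z (![1, 0] m) n
      = -(pairing (matDeriv Y i z) (matDeriv Y k z) m n
        + pairing (matDeriv Y i z) (matDeriv Y k z) n m) := by
  have hC := holomorphicNear_inclusion_add hY
  have hYi := hY.matDeriv i
  have hev : (fun w => (matDeriv Y i w)ᵀ * formMatrix * (inclusion + Y w)
      + (inclusion + Y w)ᵀ * formMatrix * matDeriv Y i w) =ᶠ[𝓝 z] fun _ => 0 := by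
    filter_upwards [hY.eventually, eventually_eventually_nhds.2 hiso] with w h1 h2
    exact isotropic_matDeriv h1 h2 i
  have h := matDeriv_congr hev k
  have hF := holomorphicNear_const (z := z) formMatrix
  rw [matDeriv_add ((hYi.transpose.mul hF).mul hC) ((hC.transpose.mul hF).mul hYi),
    matDeriv_mul (hYi.transpose.mul hF) hC, matDeriv_mul hYi.transpose hF,
    matDeriv_mul (hC.transpose.mul hF) hYi, matDeriv_mul hC.transpose hF, matDeriv_const,
    matDeriv_const, Matrix.mul_zero, Matrix.mul_zero, add_zero, add_zero, matDeriv_transpose,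
    matDeriv_transpose, matDeriv_inclusion_add hY, hYz, add_zero] at h
  have hi := matDeriv_inclusion_mul hY hinc i
  have hk := matDeriv_inclusion_mul hY hinc k
  have h' := congrFun₂ h m n
  simp only [Matrix.add_apply, Matrix.zero_apply] at h'
  rw [transpose_mul_formMatrix_mul_inclusion, inclusion_transpose_mul_formMatrix_mul,
    pairing_eq hi hk, pairing_eq hk hi, pairing_comm (matDeriv Y k z)] at h'
  linear_combination h'

end Isotropic

lemma isTangent_sum {ι : Type*} (s : Finset ι) (x : ι → ℂ) {X : ι → Matrix (Fin 7) (Fin 2) ℂ}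
    (hX : ∀ i, IsTangent (X i)) : IsTangent (∑ i ∈ s, x i • X i) := by
  constructor
  case one_one =>
    simp only [Matrix.sum_apply, Matrix.smul_apply, (hX _).one_one, smul_neg,
      Finset.sum_neg_distrib]
  all_goals
    simp [Matrix.sum_apply, (hX _).row_five, (hX _).row_six, (hX _).one_zero, (hX _).zero_one]

/-! ### Unitary frames -/

section Frame

variable {c : ℝ} {E : Fin 7 → Matrix (Fin 7) (Fin 2) ℂ}

/-- For a square matrix orthonormal rows imply orthonormal columns, so the projections of a unitary
frame resolve the identity. -/
lemma sum_smul_rankOne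
    (horth : ∀ a b, (c : ℂ) * ∑ t, (starRingEnd ℂ) (coords (E b) t) * coords (E a) t
      = if a = b then 1 else 0) : ∑ a, (c : ℂ) • rankOne (E a) = 1 := by
  set U : Mat := Matrix.of fun a t => coords (E a) t with hU
  have h1 : U * ((c : ℂ) • Uᴴ) = 1 := by
    ext a b
    rw [Matrix.one_apply, ← horth a b, Matrix.mul_smul, Matrix.smul_apply, Matrix.mul_apply,
      smul_eq_mul]
    congr 1
    exact Finset.sum_congr rfl fun t _ => mul_comm _ _
  have h2 : ((c : ℂ) • Uᴴ) * U = 1 := mul_eq_one_comm.1 h1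
  have h3 : (∑ a, (c : ℂ) • rankOne (E a)) = (((c : ℂ) • Uᴴ) * U)ᵀ := by
    ext s t
    rw [Matrix.transpose_apply, Matrix.smul_mul, Matrix.smul_apply, Matrix.mul_apply,
      Matrix.sum_apply, smul_eq_mul, Finset.mul_sum]
    refine Finset.sum_congr rfl fun a _ => ?_
    rw [Matrix.smul_apply, rankOne_apply, smul_eq_mul, mul_comm (coords (E a) s)]
    rfl
  rw [h3, h2, Matrix.transpose_one]

lemma smul_rankOne_mul
    (horth : ∀ a b, (c : ℂ) * ∑ t, (starRingEnd ℂ) (coords (E b) t) * coords (E a) t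
      = if a = b then 1 else 0) (a b : Fin 7) :
    ((c : ℂ) • rankOne (E a)) * ((c : ℂ) • rankOne (E b))
      = if a = b then (c : ℂ) • rankOne (E a) else 0 := by
  have h : ((c : ℂ) • rankOne (E a)) * ((c : ℂ) • rankOne (E b))
      = ((c : ℂ) * ∑ t, (starRingEnd ℂ) (coords (E a) t) * coords (E b) t)
        • ((c : ℂ) • Matrix.vecMulVec (coords (E a)) (star (coords (E b)))) := by
    ext s t
    rw [Matrix.mul_apply, Matrix.smul_apply, Matrix.smul_apply, Matrix.vecMulVec_apply,
      Finset.mul_sum, smul_eq_mul, Finset.sum_mul]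
    refine Finset.sum_congr rfl fun r _ => ?_
    simp only [Matrix.smul_apply, rankOne_apply, smul_eq_mul, Pi.star_apply, RCLike.star_def]
    ring
  rw [h, horth b a]
  by_cases hab : a = b
  · subst hab
    simp [rankOne]
  · simp [hab, Ne.symm hab]

lemma conjTranspose_smul_rankOne (a : Fin 7) :
    ((c : ℂ) • rankOne (E a))ᴴ = (c : ℂ) • rankOne (E a) := by
  ext s t
  simp [rankOne_apply, mul_comm]

/-- Parseval's identity for the tangential part of `T`. -/
lemma sum_trace_mul_trace (hE : ∀ a, IsTangent (E a))
    (horth : ∀ a b, (c : ℂ) * ∑ t, (starRingEnd ℂ) (coords (E b) t) * coords (E a) t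
      = if a = b then 1 else 0) (T : Matrix (Fin 7) (Fin 2) ℂ) :
    (c : ℂ) * ∑ d, ((E d)ᴴ * T).trace * (Tᴴ * E d).trace
      = ∑ t, (starRingEnd ℂ) (coords T t) * coords T t := by
  have h1 : ∀ d, (Tᴴ * E d).trace = ∑ s, (starRingEnd ℂ) (coords T s) * coords (E d) s := by
    intro d
    have h2 : Tᴴ * E d = ((E d)ᴴ * T)ᴴ := by
      rw [Matrix.conjTranspose_mul, Matrix.conjTranspose_conjTranspose]
    rw [h2, Matrix.trace_conjTranspose, (hE d).trace_conjTranspose_mul, star_sum]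
    exact Finset.sum_congr rfl fun s _ => by simp [mul_comm]
  have h2 : ∀ s t, ∑ d, (c : ℂ) * (coords (E d) s * (starRingEnd ℂ) (coords (E d) t))
      = if s = t then 1 else 0 := fun s t => by
    have := congrFun₂ (sum_smul_rankOne horth) s t
    rw [Matrix.one_apply, Matrix.sum_apply] at this
    rw [← this]
    rfl
  calc (c : ℂ) * ∑ d, ((E d)ᴴ * T).trace * (Tᴴ * E d).trace
      = ∑ d, ∑ t, ∑ s, (starRingEnd ℂ) (coords T s) * coords T t
          * ((c : ℂ) * (coords (E d) s * (starRingEnd ℂ) (coords (E d) t))) := by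
        rw [Finset.mul_sum]
        refine Finset.sum_congr rfl fun d _ => ?_
        rw [h1, (hE d).trace_conjTranspose_mul, Finset.sum_mul_sum, Finset.mul_sum]
        refine Finset.sum_congr rfl fun t _ => ?_
        rw [Finset.mul_sum]
        exact Finset.sum_congr rfl fun s _ => by ring
    _ = ∑ s, ∑ t, (starRingEnd ℂ) (coords T s) * coords T t
          * ∑ d, (c : ℂ) * (coords (E d) s * (starRingEnd ℂ) (coords (E d) t)) := by
        rw [sum_sum_sum_reverse]
        simp only [Finset.mul_sum]
    _ = _ := by
        simp only [h2, mul_ite, mul_one, mul_zero, Finset.sum_ite_eq, Finset.mem_univ, if_true]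

end Frame

/-- The derivatives of `Y` along the frame form an orthonormal basis of the tangent matrices for `c`
times the trace form. Hence the matrices `c • rankOne (E a)` are the orthogonal projections to which
`sum_curvForm_nonneg` applies. -/
theorem nonnegQuadraticBisectional_metric (c : ℝ) (hc : 0 < c) (φ : Coordinates)
    (z : Fin 7 → ℂ) (hz : z ∈ φ.domain) :
    NonnegQuadraticBisectional (fun w => (c : ℂ) • φ.metric w) z := by
  intro e he x
  obtain ⟨Y, hY, hYz, hinc, hiso, hmet⟩ := φ.exists_affine hz
  set H : (Fin 7 → ℂ) → Mat := fun w => (c : ℂ) • φ.metric w with hHdef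
  have hH := hasJet_metric (c := (c : ℂ)) hY hYz hmet
  set Y₁ : Fin 7 → Matrix (Fin 7) (Fin 2) ℂ := fun i => matDeriv Y i z with hY₁
  set S : Fin 7 → Fin 7 → Matrix (Fin 7) (Fin 2) ℂ := fun i k => matDeriv (matDeriv Y i) k z with hS
  set E : Fin 7 → Matrix (Fin 7) (Fin 2) ℂ := fun a => ∑ i, e a i • Y₁ i with hE
  set T : Fin 7 → Fin 7 → Matrix (Fin 7) (Fin 2) ℂ :=
    fun a b => ∑ i, ∑ k, (e a i * e b k) • S i k with hT
  have hEt : ∀ a, IsTangent (E a) := fun a =>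
    isTangent_sum _ _ fun i => isTangent_matDeriv hY hYz hinc hiso i
  have horth : ∀ a b, (c : ℂ) * ∑ t, (starRingEnd ℂ) (coords (E b) t) * coords (E a) t
      = if a = b then 1 else 0 := fun a b => by
    rw [← he a b, ← (hEt b).trace_conjTranspose_mul, Finset.sum_comm, hE]
    simp only []
    rw [← sum_trace_conjTranspose_mul, Finset.mul_sum]
    refine Finset.sum_congr rfl fun j _ => ?_
    rw [← sum_trace_mul, Finset.mul_sum, Finset.mul_sum]
    refine Finset.sum_congr rfl fun i _ => ?_
    rw [show H z i j = _ from (hH i j 0 0).value]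
    ring
  have hTsum : ∀ a b r m, T a b r m = ∑ i, ∑ k, e a i * e b k * S i k r m := fun a b r m => by
    simp only [hT, Matrix.sum_apply, Matrix.smul_apply, smul_eq_mul]
  have hTpair : ∀ a b m n, T a b (![1, 0] n) m + T a b (![1, 0] m) n
      = -(pairing (E a) (E b) m n + pairing (E a) (E b) n m) := fun a b m n => by
    simp only [hE, pairing_sum_sum, hTsum, ← Finset.sum_add_distrib, ← Finset.sum_neg_distrib]
    refine Finset.sum_congr rfl fun i _ => Finset.sum_congr rfl fun k _ => ?_
    have := matDeriv_matDeriv_isotropic hY hYz hinc hiso i k m n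
    linear_combination e a i * e b k * this
  have hTrow : ∀ a b m, T a b 5 m = 0 ∧ T a b 6 m = 0 := fun a b m => by
    have h : ∀ i k, S i k 5 m = 0 ∧ S i k 6 m = 0 := fun i k =>
      rows_eq_zero (matDeriv_inclusion_mul (hY.matDeriv i) (by
        filter_upwards [hY.eventually, eventually_eventually_nhds.2 hinc] with w h1 h2
        exact matDeriv_inclusion_mul h1 h2 i) k) m
    simp [hTsum, h]
  -- Of the two factors `c` on the right, one is the scaling of the curvature with the metric and
  -- the other remains on the left, where positivity of `c` removes it at the end.
  have hR : ∀ a b, c * (curvatureTensor H z (e a) (e a) (e b) (e b)).re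
      = (curvForm ((c : ℂ) • rankOne (E a)) ((c : ℂ) • rankOne (E b))).re := fun a b => by
    have h1 := curvatureTensor_frame hH he (E := E) (fun _ => rfl) (T := T) (fun _ _ => rfl) a b
    have h00 : T a b 1 0 + T a b 1 0 = -(pairing (E a) (E b) 0 0 + pairing (E a) (E b) 0 0) :=
      hTpair a b 0 0
    have h11 : T a b 0 1 + T a b 0 1 = -(pairing (E a) (E b) 1 1 + pairing (E a) (E b) 1 1) :=
      hTpair a b 1 1
    have h01 : T a b 0 0 + T a b 1 1 = -(pairing (E a) (E b) 0 1 + pairing (E a) (E b) 1 0) :=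
      hTpair a b 0 1
    have h2 := curvForm_rankOne (hEt a) (hEt b) (T := T a b) (by linear_combination h00 / 2)
      (by linear_combination h11 / 2) h01
    have h3 := sum_trace_mul_trace hEt horth (T a b)
    have h4 := trace_conjTranspose_mul_self (fun m => (hTrow a b m).1) fun m => (hTrow a b m).2
    have h5 : curvatureTensor H z (e a) (e a) (e b) (e b)
        = c * curvForm (rankOne (E a)) (rankOne (E b)) := by
      rw [h1, h2]
      -- By Parseval the inverse-metric term cancels the tangential part of `T a b`, which leaves
      -- the normal part in the Gauss equation.
      linear_combination (c : ℂ) * h3 - c * h4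
    have h6 : curvForm ((c : ℂ) • rankOne (E a)) ((c : ℂ) • rankOne (E b))
        = c * (c * curvForm (rankOne (E a)) (rankOne (E b))) := by
      simp only [← curvBilin_apply, map_smul, LinearMap.smul_apply, smul_eq_mul]
    rw [h6, ← h5, Complex.re_ofReal_mul]
  have hmain := sum_curvForm_nonneg (P := fun a => (c : ℂ) • rankOne (E a))
    (fun a => conjTranspose_smul_rankOne a) (smul_rankOne_mul horth) (sum_smul_rankOne horth) x
  simp only [← hR, mul_assoc, ← Finset.mul_sum] at hmain
  exact nonneg_of_mul_nonneg_right hmain hc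

end KahlerCSpace

end

theorem mainTheorem1 (c : ℝ) (hc : 0 < c) (φ : KahlerCSpace.Coordinates)
    (z : Fin 7 → ℂ) (hz : z ∈ φ.domain) :
    KahlerCSpace.NonnegQuadraticBisectional (fun w => (c : ℂ) • φ.metric w) z :=
  KahlerCSpace.nonnegQuadraticBisectional_metric c hc φ z hz
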